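/- Let $p$ be a prime and $n$ a positive integer, and set $t=\lfloor n/p\rfloor-1$. Let $\mathcal A_p(S_n)$ be the set of nontrivial elementary abelian $p$-subgroups of the symmetric group $S_n$, partially ordered by inclusion, and let $\Delta\mathcal A_p(S_n)$ (the Quillen complex) be its order complex, i.e. the simplicial complex whose simplices are the finite chains of $\mathcal A_p(S_n)$. Let $\mathsf C_p(n)$ (the $p$-cycle complex) be the simplicial complex whose vertices are the subgroups of $S_n$ generated by a $p$-cycle, a set of vertices being a face if and only if the subgroups in it together generate an abelian group. Both complexes contain the empty face, which has dimension $-1$. The group $S_n$ acts simplicially on both complexes by conjugation of subgroups, and $\widetilde H_j$ denotes reduced simplicial homology with complex coefficients, with the induced action of $S_n$. Then: 1. $\dim \Delta\mathcal A_p(S_n)=\dim \mathsf C_p(n)=t$; 2. for every integer $j\ge t-(p-3)$ there is an isomorphism of $\mathbb C[S_n]$-modules $\widetilde H_j(\Delta\mathcal A_p(S_n))\cong\widetilde H_j(\mathsf C_p(n))$. -/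

import Mathlib

open CategoryTheory

noncomputable section

namespace SimplicialRep

/-! ### Abstract simplicial complexes, dimension, oriented chains -/

section Complex

variable {V : Type} (K : AbstractSimplicialComplex V)

/-- The simplices of `K`, the empty simplex included (Mathlib lists only the nonempty faces). -/
def IsSimplex (s : Finset V) : Prop := s = ∅ ∨ s ∈ K.faces

/-- `dim K = d`: the largest dimension `#s - 1` of a simplex `s` is attained and equals `d`.
The empty simplex has dimension `-1`, so the complex without vertices has dimension `-1`. -/
def HasDim (d : ℤ) : Prop :=
  IsGreatest {e : ℤ | ∃ s : Finset V, IsSimplex K s ∧ e = (s.card : ℤ) - 1} d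

variable {K} in
lemma IsSimplex.mono {s t : Finset V} (hs : IsSimplex K s) (h : t ⊆ s) : IsSimplex K t := by
  rcases t.eq_empty_or_nonempty with ht | ht
  · exact Or.inl ht
  · rcases hs with rfl | hs
    · exact Or.inl (Finset.subset_empty.mp h)
    · exact Or.inr ((K.isRelLowerSet_faces hs).2 h ht)

/-- The simplices with `m` vertices (so of dimension `m - 1`), with an ordering of the vertices. -/
abbrev OrderedSimplex (m : ℕ) : Type := {v : Fin m ↪ V // IsSimplex K (Finset.univ.map v)}

variable {K}

/-- Reorder the vertices: `(v₀, …, v_k) ↦ (v_{σ 0}, …, v_{σ k})`. -/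
def OrderedSimplex.perm {m : ℕ} (v : OrderedSimplex K m) (σ : Equiv.Perm (Fin m)) :
    OrderedSimplex K m :=
  ⟨σ.toEmbedding.trans v.1, v.2.mono (by
    intro x hx
    obtain ⟨i, -, rfl⟩ := Finset.mem_map.mp hx
    exact Finset.mem_map_of_mem _ (Finset.mem_univ (σ i)))⟩

/-- Omit the `i`-th vertex: `(v₀, …, v_k) ↦ (v₀, …, v̂_i, …, v_k)`. -/
def OrderedSimplex.face {m : ℕ} (v : OrderedSimplex K (m + 1)) (i : Fin (m + 1)) :
    OrderedSimplex K m :=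
  ⟨i.succAboveEmb.trans v.1, v.2.mono (by
    intro x hx
    obtain ⟨k, -, rfl⟩ := Finset.mem_map.mp hx
    exact Finset.mem_map_of_mem _ (Finset.mem_univ (i.succAbove k)))⟩

variable (K)

/-- The relations `(v_{σ 0}, …, v_{σ k}) = sign σ • (v₀, …, v_k)`. -/
def orientationRel (m : ℕ) : Submodule ℂ (OrderedSimplex K m →₀ ℂ) :=
  Submodule.span ℂ {x | ∃ (v : OrderedSimplex K m) (σ : Equiv.Perm (Fin m)),
    x = Finsupp.single (v.perm σ) 1 - ((Equiv.Perm.sign σ : ℤ) : ℂ) • Finsupp.single v 1}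

/-- The space of oriented simplicial chains, with complex coefficients, on the simplices with `m`
vertices; these are the simplices of dimension `m - 1`. For `m = 0` it is the line spanned by the
empty simplex. -/
abbrev Chain (m : ℕ) : Type := (OrderedSimplex K m →₀ ℂ) ⧸ orientationRel K m

variable {K}

/-- The oriented simplex `[v₀, …, v_k]`. -/
def Chain.mk {m : ℕ} (v : OrderedSimplex K m) : Chain K m :=
  (orientationRel K m).mkQ (Finsupp.single v 1)

lemma Chain.mk_perm {m : ℕ} (v : OrderedSimplex K m) (σ : Equiv.Perm (Fin m)) :
    Chain.mk (v.perm σ) = ((Equiv.Perm.sign σ : ℤ) : ℂ) • Chain.mk v := by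
  rw [Chain.mk, Chain.mk, ← map_smul, ← sub_eq_zero, ← map_sub, Submodule.mkQ_apply,
    Submodule.Quotient.mk_eq_zero]
  exact Submodule.subset_span ⟨v, σ, rfl⟩

/-- The linear map on oriented chains with prescribed values on the oriented simplices. -/
def Chain.lift {m : ℕ} {M : Type*} [AddCommGroup M] [Module ℂ M] (f : OrderedSimplex K m → M)
    (hf : ∀ v σ, f (v.perm σ) = ((Equiv.Perm.sign σ : ℤ) : ℂ) • f v) : Chain K m →ₗ[ℂ] M :=
  (orientationRel K m).liftQ (Finsupp.linearCombination ℂ f) (by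
    rw [orientationRel, Submodule.span_le]
    rintro x ⟨v, σ, rfl⟩
    simp [hf v σ])

@[simp]
lemma Chain.lift_mk {m : ℕ} {M : Type*} [AddCommGroup M] [Module ℂ M] (f : OrderedSimplex K m → M)
    (hf : ∀ v σ, f (v.perm σ) = ((Equiv.Perm.sign σ : ℤ) : ℂ) • f v) (v : OrderedSimplex K m) :
    Chain.lift f hf (Chain.mk v) = f v := by
  simp [Chain.lift, Chain.mk]

lemma Chain.hom_ext {m : ℕ} {M : Type*} [AddCommGroup M] [Module ℂ M] {f g : Chain K m →ₗ[ℂ] M}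
    (h : ∀ v, f (Chain.mk v) = g (Chain.mk v)) : f = g := by
  apply Submodule.linearMap_qext
  ext v
  exact h v

/-- The permutation induced by `σ` on the positions other than `i` and `σ i`, both sets of
positions being numbered increasingly. -/
lemma exists_perm_succAbove {m : ℕ} (σ : Equiv.Perm (Fin (m + 1))) (i : Fin (m + 1)) :
    ∃ τ : Equiv.Perm (Fin m), (∀ k, σ (i.succAbove k) = (σ i).succAbove (τ k)) ∧
      ((-1) ^ (i : ℕ) * (Equiv.Perm.sign τ : ℤ) : ℤ)
        = (Equiv.Perm.sign σ : ℤ) * (-1) ^ ((σ i : Fin (m + 1)) : ℕ) := by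
  let ρ : Equiv.Perm (Fin (m + 1)) := (σ i).cycleRange * σ * i.cycleRange⁻¹
  obtain ⟨⟨a, τ⟩, hτ⟩ := (Equiv.Perm.decomposeFin (n := m)).symm.surjective ρ
  have h0 : ρ 0 = 0 := by
    simp [ρ, Equiv.Perm.inv_def, Fin.cycleRange_symm_zero]
  have ha : a = 0 := by
    rw [← Equiv.Perm.decomposeFin_symm_apply_zero a τ, hτ, h0]
  subst ha
  refine ⟨τ, fun k => ?_, ?_⟩
  · have h1 : ρ k.succ = (τ k).succ := by
      rw [← hτ, Equiv.Perm.decomposeFin_symm_apply_succ]; simp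
    rw [← Fin.cycleRange_symm_succ, ← Fin.cycleRange_symm_succ, ← h1]
    simp [ρ, Equiv.Perm.inv_def]
  · have hs : Equiv.Perm.sign τ = Equiv.Perm.sign ρ := by
      rw [← hτ, Equiv.Perm.decomposeFin.symm_sign]; simp
    rw [hs]
    simp only [ρ, Equiv.Perm.sign_mul, Equiv.Perm.sign_inv, Fin.sign_cycleRange]
    push_cast
    have := pow_mul_pow_eq_one (i : ℕ) (show (-1 : ℤ) * -1 = 1 by norm_num)
    linear_combination (((-1) ^ ((σ i : Fin (m + 1)) : ℕ) : ℤ) * (Equiv.Perm.sign σ : ℤ)) * this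

/-- The alternating sum of the faces of an ordered simplex. -/
def faceSum {m : ℕ} (v : OrderedSimplex K (m + 1)) : Chain K m :=
  ∑ i : Fin (m + 1), (-1 : ℂ) ^ (i : ℕ) • Chain.mk (v.face i)

lemma faceSum_perm {m : ℕ} (v : OrderedSimplex K (m + 1)) (σ : Equiv.Perm (Fin (m + 1))) :
    faceSum (v.perm σ) = ((Equiv.Perm.sign σ : ℤ) : ℂ) • faceSum v := by
  rw [faceSum, faceSum, Finset.smul_sum]
  refine Fintype.sum_equiv σ _ _ fun i => ?_
  obtain ⟨τ, h1, h2⟩ := exists_perm_succAbove σ i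
  have h3 : (v.perm σ).face i = (v.face (σ i)).perm τ := by
    apply Subtype.ext
    ext k
    exact congrArg (fun l => v.1 l) (h1 k)
  rw [h3, Chain.mk_perm, smul_smul, smul_smul]
  congr 1
  exact_mod_cast h2

variable (K)

/-- The boundary `∂[v₀, …, v_k] = ∑ i, (-1) ^ i [v₀, …, v̂_i, …, v_k]`. For `m = 0` it is the
augmentation `[v₀] ↦ [∅]`. -/
def boundary (m : ℕ) : Chain K (m + 1) →ₗ[ℂ] Chain K m := Chain.lift faceSum faceSum_perm

lemma boundary_boundary (m : ℕ) : boundary K m ∘ₗ boundary K (m + 1) = 0 := by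
  apply Chain.hom_ext
  intro v
  have h : boundary K m (boundary K (m + 1) (Chain.mk v)) =
      ∑ x : Fin (m + 2) × Fin (m + 1), (-1 : ℂ) ^ ((x.1 : ℕ) + (x.2 : ℕ)) •
        Chain.mk ((v.face x.1).face x.2) := by
    simp only [boundary, Chain.lift_mk, faceSum, map_sum, map_smul, Finset.smul_sum, smul_smul,
      ← pow_add, Fintype.sum_prod_type]
  rw [LinearMap.comp_apply, h, LinearMap.zero_apply]
  refine Finset.sum_involution (fun x _ => (x.1.succAbove x.2, x.2.predAbove x.1)) ?_ ?_ ?_ ?_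
  · rintro ⟨i, j⟩ -
    have h1 : (v.face (i.succAbove j)).face (j.predAbove i) = (v.face i).face j := by
      apply Subtype.ext
      ext k
      exact congrArg (fun l => v.1 l) (Fin.succAbove_succAbove_succAbove_predAbove i j k)
    dsimp only
    rw [h1, ← add_smul]
    convert zero_smul ℂ _
    rcases lt_or_ge j.castSucc i with hij | hij
    · have hij' : (j : ℕ) < i := hij
      rw [Fin.succAbove_of_castSucc_lt _ _ hij, Fin.predAbove_of_castSucc_lt _ _ hij]
      obtain ⟨d, hd⟩ : ∃ d, (i : ℕ) = d + 1 := ⟨i - 1, by omega⟩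
      simp only [Fin.val_castSucc, Fin.val_pred, hd]
      simp; ring
    · rw [Fin.succAbove_of_le_castSucc _ _ hij, Fin.predAbove_of_le_castSucc _ _ hij]
      simp; ring
  · rintro ⟨i, j⟩ - - h
    exact Fin.succAbove_ne i j (congrArg Prod.fst h)
  · intros; exact Finset.mem_univ _
  · rintro ⟨i, j⟩ -
    simp only [Prod.mk.injEq]
    refine ⟨Fin.succAbove_succAbove_predAbove i j, ?_⟩
    rcases lt_or_ge j.castSucc i with hij | hij
    · have hij' : (j : ℕ) < i := hij
      rw [Fin.succAbove_of_castSucc_lt _ _ hij, Fin.predAbove_of_castSucc_lt _ _ hij]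
      rw [Fin.predAbove_of_le_castSucc]
      · simp
      · rw [Fin.le_def]; simp; omega
    · have hij' : (i : ℕ) ≤ j := hij
      rw [Fin.succAbove_of_le_castSucc _ _ hij, Fin.predAbove_of_le_castSucc _ _ hij]
      rw [Fin.predAbove_of_castSucc_lt]
      · simp
      · rw [Fin.lt_def]; simp; omega

end Complex

/-! ### Simplicial actions and reduced homology -/

section Action

variable (G : Type) [Group G] {V : Type} [MulAction G V] (K : AbstractSimplicialComplex V)

/-- The action of `G` on the vertices of `K` is simplicial: it maps faces to faces. -/
class IsSimplicialAction : Prop where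
  smul_mem : ∀ (g : G) (s : Finset V), s ∈ K.faces →
    s.map (MulAction.toPerm g).toEmbedding ∈ K.faces

variable [IsSimplicialAction G K]

variable {G K}

/-- `g • (v₀, …, v_k) = (g • v₀, …, g • v_k)`. -/
def OrderedSimplex.act {m : ℕ} (g : G) (v : OrderedSimplex K m) : OrderedSimplex K m :=
  ⟨v.1.trans (MulAction.toPerm g).toEmbedding, by
    rw [← Finset.map_map]
    rcases v.2 with h | h
    · left; rw [h, Finset.map_empty]
    · right; exact IsSimplicialAction.smul_mem g _ h⟩

lemma Chain.mk_act_perm {m : ℕ} (g : G) (v : OrderedSimplex K m) (σ : Equiv.Perm (Fin m)) :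
    Chain.mk ((v.perm σ).act g) = ((Equiv.Perm.sign σ : ℤ) : ℂ) • Chain.mk (v.act g) :=
  Chain.mk_perm (v.act g) σ

/-- The linear map `[v₀, …, v_k] ↦ [g • v₀, …, g • v_k]` on oriented chains. -/
def chainAct (m : ℕ) (g : G) : Chain K m →ₗ[ℂ] Chain K m :=
  Chain.lift (fun v => Chain.mk (v.act g)) (Chain.mk_act_perm g)

@[simp]
lemma chainAct_mk {m : ℕ} (g : G) (v : OrderedSimplex K m) :
    chainAct m g (Chain.mk v) = Chain.mk (v.act g) :=
  Chain.lift_mk _ _ v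

variable (G K)

/-- The representation of `G` on the oriented chains, `g • [v₀, …, v_k] = [g • v₀, …, g • v_k]`. -/
def chainRep (m : ℕ) : Representation ℂ G (Chain K m) where
  toFun g := chainAct m g
  map_one' := by
    apply Chain.hom_ext
    intro v
    rw [chainAct_mk, Module.End.one_apply]
    congr 1
    apply Subtype.ext
    ext k
    exact one_smul G (v.1 k)
  map_mul' g h := by
    apply Chain.hom_ext
    intro v
    rw [Module.End.mul_apply, chainAct_mk, chainAct_mk, chainAct_mk]
    congr 1
    apply Subtype.ext
    ext k
    exact mul_smul g h (v.1 k)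

lemma boundary_comm (m : ℕ) (g : G) :
    boundary K m ∘ₗ chainRep G K (m + 1) g = chainRep G K m g ∘ₗ boundary K m := by
  apply Chain.hom_ext
  intro v
  change boundary K m (chainAct (m + 1) g (Chain.mk v)) =
    chainAct m g (boundary K m (Chain.mk v))
  simp only [boundary, chainAct_mk, Chain.lift_mk, faceSum, map_sum, map_smul]
  rfl

/-- The augmented oriented chain complex of `K`, as a complex of representations of `G` over `ℂ`.
The term in degree `m` is spanned by the simplices with `m` vertices. -/
def augmentedChainComplex : ChainComplex (Rep.{0} ℂ G) ℕ :=
  ChainComplex.of (fun m => Rep.of (chainRep G K m))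
    (fun m => Rep.ofHom ⟨boundary K m, boundary_comm G K m⟩)
    (fun m => by
      ext1
      apply Representation.IntertwiningMap.toLinearMap_injective
      exact boundary_boundary K m)

/-- The reduced simplicial homology `H̃_j(K; ℂ)` for `j : ℤ`, as a representation of `G` over `ℂ`.
A simplex of dimension `j` has `j + 1` vertices, so this is the homology of the augmented chain
complex in degree `j + 1` if `j ≥ -1`; it is zero if `j < -1`. -/
def reducedHomology (j : ℤ) : Rep.{0} ℂ G :=
  if 0 ≤ j + 1 then (augmentedChainComplex G K).homology (j + 1).toNat
  else Rep.of (Representation.trivial ℂ G PUnit)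

end Action

/-! ### The Quillen complex -/

/-- The order complex of a poset: the faces are the nonempty finite chains. -/
def orderComplex (P : Type) [PartialOrder P] : AbstractSimplicialComplex P where
  faces := {s | s.Nonempty ∧ IsChain (· ≤ ·) (s : Set P)}
  isRelLowerSet_faces := fun _ hs =>
    ⟨hs.1, fun _ hts ht => ⟨ht, hs.2.mono (Finset.coe_subset.mpr hts)⟩⟩
  singleton_mem v := ⟨Finset.singleton_nonempty v, by simp⟩

/-- `H` is a nontrivial elementary abelian `p`-group. -/
def IsNontrivialElementaryAbelian (p : ℕ) {G : Type} [Group G] (H : Subgroup G) : Prop :=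
  H ≠ ⊥ ∧ IsMulCommutative H ∧ ∀ x ∈ H, x ^ p = 1

/-- The set `𝒜_p(G)` of nontrivial elementary abelian `p`-subgroups of `G`, ordered by
inclusion. -/
abbrev ElementaryAbelianSubgroups (p : ℕ) (G : Type) [Group G] : Type :=
  {H : Subgroup G // IsNontrivialElementaryAbelian p H}

lemma isMulCommutative_of_le {G : Type} [Group G] {H L : Subgroup G} (hHL : H ≤ L)
    (h : IsMulCommutative L) : IsMulCommutative H := by
  refine ⟨⟨?_⟩⟩
  rintro ⟨x, hx⟩ ⟨y, hy⟩
  have := congrArg Subtype.val (h.is_comm.comm ⟨x, hHL hx⟩ ⟨y, hHL hy⟩)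
  apply Subtype.ext
  simpa using this

lemma isMulCommutative_map {G : Type} [Group G] {H : Subgroup G} (f : G →* G)
    (h : IsMulCommutative H) : IsMulCommutative (H.map f) := by
  refine ⟨⟨?_⟩⟩
  rintro ⟨_, x, hx, rfl⟩ ⟨_, y, hy, rfl⟩
  have := congrArg Subtype.val (h.is_comm.comm ⟨x, hx⟩ ⟨y, hy⟩)
  apply Subtype.ext
  simpa using congrArg f this

lemma IsNontrivialElementaryAbelian.conj {p : ℕ} {G : Type} [Group G] {H : Subgroup G}
    (h : IsNontrivialElementaryAbelian p H) (g : G) :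
    IsNontrivialElementaryAbelian p (H.map (MulAut.conj g).toMonoidHom) := by
  obtain ⟨h1, h2, h3⟩ := h
  refine ⟨?_, isMulCommutative_map _ h2, ?_⟩
  · rwa [Ne, Subgroup.map_eq_bot_iff_of_injective _ (MulAut.conj g).injective]
  · rintro _ ⟨x, hx, rfl⟩
    rw [← map_pow, h3 x hx, map_one]

lemma map_conj_one {G : Type} [Group G] (H : Subgroup G) :
    H.map (MulAut.conj (1 : G)).toMonoidHom = H := by
  ext x; simp [Subgroup.mem_map]

lemma map_conj_mul {G : Type} [Group G] (g h : G) (H : Subgroup G) :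
    H.map (MulAut.conj (g * h)).toMonoidHom =
      (H.map (MulAut.conj h).toMonoidHom).map (MulAut.conj g).toMonoidHom := by
  rw [Subgroup.map_map, map_mul]; rfl

/-- `G` acts on its nontrivial elementary abelian `p`-subgroups by conjugation,
`g • H = g H g⁻¹`. -/
instance (p : ℕ) (G : Type) [Group G] : MulAction G (ElementaryAbelianSubgroups p G) where
  smul g H := ⟨H.1.map (MulAut.conj g).toMonoidHom, H.2.conj g⟩
  one_smul H := Subtype.ext (map_conj_one H.1)
  mul_smul g h H := Subtype.ext (map_conj_mul g h H.1)

/-- The Quillen complex `Δ𝒜_p(G)`. -/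
abbrev quillenComplex (p : ℕ) (G : Type) [Group G] :
    AbstractSimplicialComplex (ElementaryAbelianSubgroups p G) :=
  orderComplex (ElementaryAbelianSubgroups p G)

instance (p : ℕ) (G : Type) [Group G] : IsSimplicialAction G (quillenComplex p G) where
  smul_mem g s hs := by
    refine ⟨hs.1.map, ?_⟩
    intro x hx y hy hxy
    rw [Finset.mem_coe, Finset.mem_map] at hx hy
    obtain ⟨x, hx, rfl⟩ := hx
    obtain ⟨y, hy, rfl⟩ := hy
    rcases hs.2.total hx hy with h | h
    · exact Or.inl (Subgroup.map_mono h)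
    · exact Or.inr (Subgroup.map_mono h)

/-! ### The `p`-cycle complex -/

/-- `H` is generated by a `p`-cycle. -/
def IsGeneratedByCycle (p : ℕ) {n : ℕ} (H : Subgroup (Equiv.Perm (Fin n))) : Prop :=
  ∃ c : Equiv.Perm (Fin n), c.IsCycle ∧ c.support.card = p ∧ H = Subgroup.zpowers c

/-- The subgroups of `S_n` that are generated by a `p`-cycle. -/
abbrev CycleSubgroups (p n : ℕ) : Type :=
  {H : Subgroup (Equiv.Perm (Fin n)) // IsGeneratedByCycle p H}

lemma IsGeneratedByCycle.conj {p n : ℕ} {H : Subgroup (Equiv.Perm (Fin n))}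
    (h : IsGeneratedByCycle p H) (g : Equiv.Perm (Fin n)) :
    IsGeneratedByCycle p (H.map (MulAut.conj g).toMonoidHom) := by
  obtain ⟨c, h1, h2, rfl⟩ := h
  refine ⟨g * c * g⁻¹, h1.conj, ?_, ?_⟩
  · rw [Equiv.Perm.card_support_conj, h2]
  · rw [MonoidHom.map_zpowers]; rfl

/-- `S_n` acts on its subgroups generated by a `p`-cycle by conjugation, `g • H = g H g⁻¹`. -/
instance (p n : ℕ) : MulAction (Equiv.Perm (Fin n)) (CycleSubgroups p n) where
  smul g H := ⟨H.1.map (MulAut.conj g).toMonoidHom, H.2.conj g⟩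
  one_smul H := Subtype.ext (map_conj_one H.1)
  mul_smul g h H := Subtype.ext (map_conj_mul g h H.1)

/-- The `p`-cycle complex `C_p(n)`: the vertices are the subgroups of `S_n` generated by a
`p`-cycle, and a nonempty finite set of vertices is a face if together they generate an abelian
group. -/
def cycleComplex (p n : ℕ) : AbstractSimplicialComplex (CycleSubgroups p n) where
  faces := {s | s.Nonempty ∧ IsMulCommutative ↥(⨆ H ∈ s, H.1)}
  isRelLowerSet_faces := by
    rintro s ⟨hs, hc⟩
    exact ⟨hs, fun t hts ht => ⟨ht, isMulCommutative_of_le (biSup_mono fun _ h => hts h) hc⟩⟩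
  singleton_mem v := by
    refine ⟨Finset.singleton_nonempty v, ?_⟩
    have h : (⨆ H ∈ ({v} : Finset (CycleSubgroups p n)), H.1) = v.1 := by
      simp only [Finset.mem_singleton, iSup_iSup_eq_left]
    rw [h]
    obtain ⟨c, -, -, hc⟩ := v.2
    rw [hc]
    infer_instance

instance (p n : ℕ) : IsSimplicialAction (Equiv.Perm (Fin n)) (cycleComplex p n) where
  smul_mem g s hs := by
    refine ⟨hs.1.map, ?_⟩
    have h : (⨆ H ∈ s.map (MulAction.toPerm g).toEmbedding, H.1) =
        (⨆ H ∈ s, H.1).map (MulAut.conj g).toMonoidHom := by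
      rw [Subgroup.map_iSup]
      simp only [Subgroup.map_iSup, Finset.mem_map, iSup_exists, iSup_and]
      rw [iSup_comm]
      refine iSup_congr fun H => ?_
      rw [iSup_comm]
      refine iSup_congr fun hH => ?_
      exact iSup_iSup_eq_right
    rw [h]
    exact isMulCommutative_map _ hs.2

end SimplicialRep

end

/-! The two complexes are compared through the poset P of those E for which the cycles of all
elements of E commute (`CommutingCycleSubgroups`). Sending E to the set of groups generated by these
cycles (`cycleSet`) is a monotone map from P to the face poset of the cycle complex. Over the
subsets of a face s there is a greatest E, the group generated by s: its cycles generate exactly the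
members of s (`cycleSet_biSup`), and every E lies in the group generated by its cycles
(`le_biSup_cycleSet`). Quillen's fiber lemma then identifies the homology of ΔP with that of the
cycle complex in all degrees. To respect the group action, the fiber lemma is proved with acyclic
carriers whose cones are averaged over a set of apexes permuted by the group; over ℂ this yields
equivariant chain maps and homotopies.

ΔP is a full subcomplex of the Quillen complex, and only small simplices are missing from it. An
elementary abelian E embeds in the product of its orbits, so its rank is at most the sum of the a
over the orbits of size p^a. Since p a ≤ p^a, the rank is at most ⌊n/p⌋. If all orbits have at most
p points, then E is in P (`cycleSet_mem_faces`). An orbit of size p^a with a ≥ 2 satisfies p (a + p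
- 2) ≤ p^a and lowers the bound by p - 2 (`exists_card_eq_pow`). A chain that leaves P therefore has
at most ⌊n/p⌋ - p + 2 vertices, whereas j ≥ t - (p - 3) means j + 1 ≥ ⌊n/p⌋ - p + 3. So the
inclusion is bijective on chains in dimension j and above and injective below, which suffices for an
isomorphism in degree j (`quasiIsoAt_of_bijective`). -/

open CategoryTheory

noncomputable section

namespace SimplicialRep

/-! ### Cones on oriented chains -/

section Cone

variable {V : Type} {K : AbstractSimplicialComplex V}

open Classical in
/-- The oriented simplex `[w₀, …, w_k]`, understood to be zero if two of the vertices agree or if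
the vertices do not form a simplex. -/
def Chain.ofFun (K : AbstractSimplicialComplex V) {m : ℕ} (w : Fin m → V) : Chain K m :=
  if h : ∃ v : OrderedSimplex K m, ⇑v.1 = w then Chain.mk h.choose else 0

lemma Chain.ofFun_coe {m : ℕ} (v : OrderedSimplex K m) : Chain.ofFun K v.1 = Chain.mk v := by
  have h : ∃ v' : OrderedSimplex K m, ⇑v'.1 = v.1 := ⟨v, rfl⟩
  rw [Chain.ofFun, dif_pos h]
  congr 1
  exact Subtype.ext (DFunLike.coe_injective h.choose_spec)

lemma Chain.ofFun_eq_zero {m : ℕ} {w : Fin m → V} (h : ¬ Function.Injective w) :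
    Chain.ofFun K w = 0 := by
  rw [Chain.ofFun, dif_neg]
  rintro ⟨v, rfl⟩
  exact h v.1.injective

lemma Chain.ofFun_perm {m : ℕ} (w : Fin m → V) (σ : Equiv.Perm (Fin m)) :
    Chain.ofFun K (w ∘ σ) = ((Equiv.Perm.sign σ : ℤ) : ℂ) • Chain.ofFun K w := by
  by_cases h : ∃ v : OrderedSimplex K m, ⇑v.1 = w
  · obtain ⟨v, rfl⟩ := h
    rw [Chain.ofFun_coe, ← Chain.mk_perm, ← Chain.ofFun_coe]
    rfl
  · have h' : ¬ ∃ v : OrderedSimplex K m, ⇑v.1 = w ∘ σ := by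
      rintro ⟨v, hv⟩
      refine h ⟨v.perm σ⁻¹, ?_⟩
      funext i
      change v.1 (σ⁻¹ i) = w i
      rw [hv]; simp
    rw [Chain.ofFun, dif_neg h', Chain.ofFun, dif_neg h, smul_zero]

/-- The permutation on the right fixes position 0 and has the sign of `σ`; this makes the cone well
defined on oriented chains. -/
lemma Chain.cons_comp_perm {m : ℕ} (a : V) (w : Fin m → V) (σ : Equiv.Perm (Fin m)) :
    (Fin.cons a (w ∘ σ) : Fin (m + 1) → V) =
      Fin.cons a w ∘ Equiv.Perm.decomposeFin.symm (0, σ) := by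
  funext i
  refine Fin.cases ?_ (fun i => ?_) i <;> simp

/-- The cone `[v₀, …, v_k] ↦ [a, v₀, …, v_k]` on oriented chains. -/
def cone (K : AbstractSimplicialComplex V) (m : ℕ) (a : V) : Chain K m →ₗ[ℂ] Chain K (m + 1) :=
  Chain.lift (fun v => Chain.ofFun K (Fin.cons a v.1)) (fun v σ => by
    change Chain.ofFun K (Fin.cons a (v.1 ∘ σ)) = _
    rw [Chain.cons_comp_perm, Chain.ofFun_perm, Equiv.Perm.decomposeFin.symm_sign]
    simp)

lemma cone_mk {m : ℕ} (a : V) (v : OrderedSimplex K m) :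
    cone K m a (Chain.mk v) = Chain.ofFun K (Fin.cons a v.1) :=
  Chain.lift_mk _ _ v

lemma boundary_mk {m : ℕ} (v : OrderedSimplex K (m + 1)) :
    boundary K m (Chain.mk v) = ∑ i : Fin (m + 1), (-1 : ℂ) ^ (i : ℕ) • Chain.mk (v.face i) :=
  Chain.lift_mk _ _ v

/-- The chains spanned by the simplices in `Φ`. -/
def supportedChains (K : AbstractSimplicialComplex V) (m : ℕ) (Φ : Set (Finset V)) :
    Submodule ℂ (Chain K m) :=
  Submodule.span ℂ (Chain.mk '' {v : OrderedSimplex K m | Finset.univ.map v.1 ∈ Φ})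

lemma mk_mem_supportedChains {m : ℕ} {Φ : Set (Finset V)} {v : OrderedSimplex K m}
    (h : Finset.univ.map v.1 ∈ Φ) : Chain.mk v ∈ supportedChains K m Φ :=
  Submodule.subset_span ⟨v, h, rfl⟩

lemma supportedChains_mono {m : ℕ} {Φ Ψ : Set (Finset V)} (h : Φ ⊆ Ψ) :
    supportedChains K m Φ ≤ supportedChains K m Ψ :=
  Submodule.span_mono (Set.image_mono fun _ hv => h hv)

/-- The empty simplex. -/
def emptySimplex (K : AbstractSimplicialComplex V) : OrderedSimplex K 0 :=
  ⟨⟨Fin.elim0, fun i => i.elim0⟩, Or.inl (by simp)⟩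

lemma eq_emptySimplex (v : OrderedSimplex K 0) : v = emptySimplex K := by
  apply Subtype.ext
  ext i
  exact i.elim0

variable [DecidableEq V]

lemma exists_cons {m : ℕ} {a : V} {v : OrderedSimplex K m} (ha : a ∉ Finset.univ.map v.1)
    (h : IsSimplex K (insert a (Finset.univ.map v.1))) :
    ∃ u : OrderedSimplex K (m + 1), ⇑u.1 = Fin.cons a v.1 ∧
      Finset.univ.map u.1 = insert a (Finset.univ.map v.1) := by
  have hinj : Function.Injective (Fin.cons a v.1 : Fin (m + 1) → V) := by
    rw [Fin.cons_injective_iff]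
    refine ⟨?_, v.1.injective⟩
    rintro ⟨i, rfl⟩
    exact ha (Finset.mem_map_of_mem _ (Finset.mem_univ i))
  have he : Finset.univ.map (⟨Fin.cons a v.1, hinj⟩ : Fin (m + 1) ↪ V) =
      insert a (Finset.univ.map v.1) := by
    ext x
    simp [Fin.exists_fin_succ, eq_comm]
  exact ⟨⟨⟨Fin.cons a v.1, hinj⟩, he ▸ h⟩, rfl, he⟩

lemma boundary_cone_mk_zero (a : V) (v : OrderedSimplex K 0) :
    boundary K 0 (cone K 0 a (Chain.mk v)) = Chain.mk v := by
  have hv : Finset.univ.map v.1 = ∅ := by simp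
  obtain ⟨u, hu, -⟩ := exists_cons (K := K) (a := a) (v := v) (by simp) (by
    rw [hv]; exact Or.inr (K.singleton_mem a))
  rw [cone_mk, ← hu, Chain.ofFun_coe, boundary_mk, Fin.sum_univ_succ, Fin.sum_univ_zero, add_zero,
    Fin.val_zero, pow_zero, one_smul]
  congr 1
  apply Subtype.ext
  ext i
  exact i.elim0

/-- If `a` is a new vertex, omitting it from the cone returns `v`, and the other faces cancel
against the cone over the boundary. If `a` is the `i`-th vertex of `v`, the cone vanishes and only
the cone over the `i`-th face survives; moving `a` back to its place costs the sign `(-1) ^ i`,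
which cancels the one in the boundary. -/
lemma boundary_cone_mk {m : ℕ} (a : V) (v : OrderedSimplex K (m + 1))
    (h : IsSimplex K (insert a (Finset.univ.map v.1))) :
    boundary K (m + 1) (cone K (m + 1) a (Chain.mk v)) + cone K m a (boundary K m (Chain.mk v)) =
      Chain.mk v := by
  simp only [boundary_mk v, map_sum, map_smul, cone_mk]
  by_cases ha : a ∈ Finset.univ.map v.1
  · obtain ⟨i, -, rfl⟩ := Finset.mem_map.mp ha
    have h0 : ¬ Function.Injective (Fin.cons (v.1 i) v.1 : Fin (m + 2) → V) := by
      rw [Fin.cons_injective_iff]; simp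
    rw [Chain.ofFun_eq_zero h0, map_zero, zero_add, Finset.sum_eq_single i]
    · have h1 : (Fin.cons (v.1 i) (v.face i).1 : Fin (m + 1) → V) =
          v.1 ∘ (i.cycleRange).symm := by
        funext k
        refine Fin.cases ?_ (fun k => ?_) k
        · simp [Fin.cycleRange_symm_zero]
        · simp [Fin.cycleRange_symm_succ, OrderedSimplex.face]
      rw [h1, Chain.ofFun_perm, Chain.ofFun_coe, smul_smul, Equiv.Perm.sign_symm,
        Fin.sign_cycleRange]
      push_cast
      rw [← mul_pow]; simp
    · intro k _ hk
      rw [Chain.ofFun_eq_zero, smul_zero]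
      rw [Fin.cons_injective_iff]
      rintro ⟨h2, -⟩
      obtain ⟨l, hl⟩ := Fin.exists_succAbove_eq hk.symm
      exact h2 ⟨l, congrArg v.1 hl⟩
    · simp
  · obtain ⟨u, hu, -⟩ := exists_cons ha h
    rw [← hu, Chain.ofFun_coe, boundary_mk, Fin.sum_univ_succ]
    have h0 : u.face 0 = v := by
      apply Subtype.ext
      ext k
      change u.1 _ = _
      rw [hu]; simp
    have h1 : ∀ i : Fin (m + 1),
        Chain.mk (u.face i.succ) = Chain.ofFun K (Fin.cons a (v.face i).1) := by
      intro i
      rw [← Chain.ofFun_coe]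
      congr 1
      funext k
      change u.1 _ = _
      rw [hu]
      refine Fin.cases ?_ (fun k => ?_) k <;> simp [OrderedSimplex.face]
    simp only [h0, h1, Fin.val_succ, pow_succ]
    simp

/-- The average of the cones with apex in `T`. -/
def avgCone (K : AbstractSimplicialComplex V) (m : ℕ) (T : Finset V) :
    Chain K m →ₗ[ℂ] Chain K (m + 1) :=
  (T.card : ℂ)⁻¹ • ∑ a ∈ T, cone K m a

lemma avgCone_mem {m : ℕ} {Φ : Set (Finset V)} {T : Finset V}
    (hΦ : ∀ a ∈ T, ∀ w ∈ Φ, insert a w ∈ Φ ∧ IsSimplex K (insert a w)) {x : Chain K m}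
    (hx : x ∈ supportedChains K m Φ) : avgCone K m T x ∈ supportedChains K (m + 1) Φ := by
  simp only [avgCone, LinearMap.smul_apply, LinearMap.sum_apply]
  refine Submodule.smul_mem _ _ (Submodule.sum_mem _ fun a ha => ?_)
  suffices h : supportedChains K m Φ ≤ (supportedChains K (m + 1) Φ).comap (cone K m a) from h hx
  rw [supportedChains, Submodule.span_le]
  rintro _ ⟨v, hv, rfl⟩
  change cone K m a (Chain.mk v) ∈ supportedChains K (m + 1) Φ
  rw [cone_mk]
  obtain ⟨h1, h2⟩ := hΦ a ha _ hv
  by_cases hav : a ∈ Finset.univ.map v.1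
  · rw [Chain.ofFun_eq_zero]
    · exact Submodule.zero_mem _
    · obtain ⟨i, -, rfl⟩ := Finset.mem_map.mp hav
      rw [Fin.cons_injective_iff]; simp
  · obtain ⟨u, hu, hu'⟩ := exists_cons hav h2
    rw [← hu, Chain.ofFun_coe]
    exact mk_mem_supportedChains (hu' ▸ h1)

lemma boundary_avgCone_zero {T : Finset V} (hT : T.Nonempty) (x : Chain K 0) :
    boundary K 0 (avgCone K 0 T x) = x := by
  have h : ∀ a, boundary K 0 (cone K 0 a x) = x := fun a =>
    LinearMap.congr_fun (Chain.hom_ext (f := boundary K 0 ∘ₗ cone K 0 a) (g := LinearMap.id)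
      (boundary_cone_mk_zero a)) x
  have hc : (T.card : ℂ) ≠ 0 := by exact_mod_cast hT.card_pos.ne'
  simp only [avgCone, LinearMap.smul_apply, LinearMap.sum_apply, map_smul, map_sum, h,
    Finset.sum_const]
  rw [← Nat.cast_smul_eq_nsmul ℂ, smul_smul, inv_mul_cancel₀ hc, one_smul]

lemma boundary_avgCone {m : ℕ} {Φ : Set (Finset V)} {T : Finset V} (hT : T.Nonempty)
    (hΦ : ∀ a ∈ T, ∀ w ∈ Φ, IsSimplex K (insert a w)) {x : Chain K (m + 1)}
    (hx : x ∈ supportedChains K (m + 1) Φ) :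
    boundary K (m + 1) (avgCone K (m + 1) T x) + avgCone K m T (boundary K m x) = x := by
  have h : ∀ a ∈ T, boundary K (m + 1) (cone K (m + 1) a x) + cone K m a (boundary K m x) = x := by
    intro a ha
    suffices h : supportedChains K (m + 1) Φ ≤ LinearMap.eqLocus
        (boundary K (m + 1) ∘ₗ cone K (m + 1) a + cone K m a ∘ₗ boundary K m) LinearMap.id from
      h hx
    rw [supportedChains, Submodule.span_le]
    rintro _ ⟨v, hv, rfl⟩
    exact boundary_cone_mk a v (hΦ a ha _ hv)
  have hc : (T.card : ℂ) ≠ 0 := by exact_mod_cast hT.card_pos.ne'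
  simp only [avgCone, LinearMap.smul_apply, LinearMap.sum_apply, map_smul, map_sum]
  rw [← smul_add, ← Finset.sum_add_distrib, Finset.sum_congr rfl h, Finset.sum_const,
    ← Nat.cast_smul_eq_nsmul ℂ, smul_smul, inv_mul_cancel₀ hc, one_smul]

end Cone

/-! ### Equivariance of cones -/

section Equivariance

variable {G : Type} [Group G] {V : Type} [MulAction G V] {K : AbstractSimplicialComplex V}
  [IsSimplicialAction G K]

lemma chainAct_ofFun {m : ℕ} (g : G) (w : Fin m → V) :
    chainAct m g (Chain.ofFun K w) = Chain.ofFun K (fun i => g • w i) := by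
  by_cases h : ∃ v : OrderedSimplex K m, ⇑v.1 = w
  · obtain ⟨v, rfl⟩ := h
    rw [Chain.ofFun_coe, chainAct_mk, ← Chain.ofFun_coe]
    rfl
  · have h' : ¬ ∃ v : OrderedSimplex K m, ⇑v.1 = fun i => g • w i := by
      rintro ⟨v, hv⟩
      refine h ⟨v.act g⁻¹, ?_⟩
      funext i
      change g⁻¹ • v.1 i = w i
      rw [hv, inv_smul_smul]
    rw [Chain.ofFun, dif_neg h, Chain.ofFun, dif_neg h', map_zero]

lemma chainAct_cone {m : ℕ} (g : G) (a : V) (x : Chain K m) :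
    chainAct (m + 1) g (cone K m a x) = cone K m (g • a) (chainAct m g x) := by
  refine LinearMap.congr_fun (Chain.hom_ext (f := chainAct (m + 1) g ∘ₗ cone K m a)
    (g := cone K m (g • a) ∘ₗ chainAct m g) fun v => ?_) x
  rw [LinearMap.comp_apply, LinearMap.comp_apply, chainAct_mk, cone_mk, cone_mk, chainAct_ofFun]
  congr 1
  funext i
  refine Fin.cases ?_ (fun i => ?_) i
  · simp
  · simp only [Fin.cons_succ]; rfl

/-- A single apex need not be fixed by its stabilizing symmetries, but a set of apexes can be
carried to a set of apexes. This is the purpose of averaging, at the price of dividing by the number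
of apexes. -/
lemma chainAct_avgCone {m : ℕ} (g : G) (T : Finset V) (x : Chain K m) :
    chainAct (m + 1) g (avgCone K m T x) =
      avgCone K m (T.map (MulAction.toPerm g).toEmbedding) (chainAct m g x) := by
  simp only [avgCone, LinearMap.smul_apply, LinearMap.sum_apply, map_smul, map_sum, chainAct_cone,
    Finset.card_map, Finset.sum_map]
  rfl

lemma map_act {m : ℕ} (g : G) (v : OrderedSimplex K m) :
    Finset.univ.map (v.act g).1 =
      (Finset.univ.map v.1).map (MulAction.toPerm g).toEmbedding := by
  rw [Finset.map_map]; rfl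

end Equivariance

/-! ### Acyclic carriers -/

/-- An acyclic carrier from `K` to `L`: every simplex `s` of `K` is assigned a subcomplex of `L`
which is a cone over each of the vertices in the set `apexes s`. -/
structure Carrier {V W : Type} (K : AbstractSimplicialComplex V) (L : AbstractSimplicialComplex W)
    [DecidableEq W] where
  /-- the subcomplex assigned to a simplex -/
  sub : Finset V → Set (Finset W)
  /-- the set of apexes of this subcomplex -/
  apexes : Finset V → Finset W
  -- The empty simplex is not in `K.faces` and needs no apex: in degree 0 the chain map is
  -- prescribed and the homotopy is zero.
  apexes_nonempty : ∀ s ∈ K.faces, (apexes s).Nonempty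
  isSimplex : ∀ s ∈ K.faces, ∀ w ∈ sub s, IsSimplex L w
  insert_mem : ∀ s ∈ K.faces, ∀ a ∈ apexes s, ∀ w ∈ sub s, insert a w ∈ sub s
  mono : ∀ s t, s ⊆ t → sub s ⊆ sub t
  empty_mem : ∀ s, ∅ ∈ sub s

namespace Carrier

variable {V W : Type} {K : AbstractSimplicialComplex V} {L : AbstractSimplicialComplex W}
  [DecidableEq W] (c : Carrier K L)

/-- The linear map `r` maps every oriented simplex to a chain in the subcomplex that the carrier
assigns to the simplex. -/
def Carries {m k : ℕ} (r : Chain K m →ₗ[ℂ] Chain L k) : Prop :=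
  ∀ v : OrderedSimplex K m, r (Chain.mk v) ∈ supportedChains L k (c.sub (Finset.univ.map v.1))

variable {c}

lemma Carries.comp_boundary {m k : ℕ} {r : Chain K m →ₗ[ℂ] Chain L k} (h : c.Carries r) :
    c.Carries (r ∘ₗ boundary K m) := by
  intro v
  rw [LinearMap.comp_apply, boundary_mk, map_sum]
  refine Submodule.sum_mem _ fun i _ => ?_
  rw [map_smul]
  refine Submodule.smul_mem _ _ (supportedChains_mono (c.mono _ _ ?_) (h _))
  intro x hx
  obtain ⟨k, -, rfl⟩ := Finset.mem_map.mp hx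
  exact Finset.mem_map_of_mem _ (Finset.mem_univ (i.succAbove k))

lemma Carries.sub {m k : ℕ} {r r' : Chain K m →ₗ[ℂ] Chain L k} (h : c.Carries r)
    (h' : c.Carries r') : c.Carries (r - r') :=
  fun v => Submodule.sub_mem _ (h v) (h' v)

lemma map_univ_perm {m : ℕ} (v : OrderedSimplex K m) (σ : Equiv.Perm (Fin m)) :
    Finset.univ.map (v.perm σ).1 = Finset.univ.map v.1 := by
  change Finset.univ.map (σ.toEmbedding.trans v.1) = _
  rw [← Finset.map_map, Finset.map_univ_equiv]

variable (c)

/-- Cone off the values of `r`. -/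
def raise {m k : ℕ} (r : Chain K m →ₗ[ℂ] Chain L k) : Chain K m →ₗ[ℂ] Chain L (k + 1) :=
  Chain.lift (fun v => avgCone L k (c.apexes (Finset.univ.map v.1)) (r (Chain.mk v)))
    (fun v σ => by rw [Chain.mk_perm, map_smul, map_smul, map_univ_perm])

lemma raise_mk {m k : ℕ} (r : Chain K m →ₗ[ℂ] Chain L k) (v : OrderedSimplex K m) :
    c.raise r (Chain.mk v) = avgCone L k (c.apexes (Finset.univ.map v.1)) (r (Chain.mk v)) :=
  Chain.lift_mk _ _ v

lemma map_mem_faces {m : ℕ} (v : OrderedSimplex K (m + 1)) : Finset.univ.map v.1 ∈ K.faces := by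
  rcases v.2 with h | h
  · exact absurd h (by simp [Finset.univ_eq_empty_iff])
  · exact h

variable {c}

lemma Carries.raise {m k : ℕ} {r : Chain K (m + 1) →ₗ[ℂ] Chain L k} (h : c.Carries r) :
    c.Carries (c.raise r) := by
  intro v
  rw [raise_mk]
  have hv := map_mem_faces v
  exact avgCone_mem (fun a ha w hw => ⟨c.insert_mem _ hv a ha w hw,
    c.isSimplex _ hv _ (c.insert_mem _ hv a ha w hw)⟩) (h v)

variable (c) in
lemma boundary_raise_zero {m : ℕ} (r : Chain K (m + 1) →ₗ[ℂ] Chain L 0) :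
    boundary L 0 ∘ₗ c.raise r = r := by
  apply Chain.hom_ext
  intro v
  rw [LinearMap.comp_apply, raise_mk, boundary_avgCone_zero (c.apexes_nonempty _ (map_mem_faces v))]

/-- When the values of `r` are cycles, the cone over their boundary drops out of the cone identity,
so coning off gives preimages under the boundary. Both inductive constructions below rest on this.
-/
lemma Carries.boundary_raise {m k : ℕ} {r : Chain K (m + 1) →ₗ[ℂ] Chain L (k + 1)}
    (h : c.Carries r) (hr : boundary L k ∘ₗ r = 0) : boundary L (k + 1) ∘ₗ c.raise r = r := by
  apply Chain.hom_ext
  intro v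
  have hv := map_mem_faces v
  have h1 := boundary_avgCone (c.apexes_nonempty _ hv) (fun a ha w hw =>
    c.isSimplex _ hv _ (c.insert_mem _ hv a ha w hw)) (h v)
  have h2 : boundary L k (r (Chain.mk v)) = 0 := LinearMap.congr_fun hr _
  rw [h2, map_zero, add_zero] at h1
  rw [LinearMap.comp_apply, raise_mk, h1]

/-! ### The chain map -/

variable (c) in
/-- A chain map carried by `c`. -/
def chainMap : (m : ℕ) → Chain K m →ₗ[ℂ] Chain L m
  | 0 => Chain.lift (fun _ => Chain.mk (emptySimplex L)) (fun v σ => by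
      rw [Subsingleton.elim σ 1]; simp)
  | m + 1 => c.raise (chainMap m ∘ₗ boundary K m)

lemma chainMap_zero_mk (v : OrderedSimplex K 0) :
    c.chainMap 0 (Chain.mk v) = Chain.mk (emptySimplex L) :=
  Chain.lift_mk _ _ v

lemma chainMap_carries (m : ℕ) : c.Carries (c.chainMap m) := by
  induction m with
  | zero =>
    intro v
    rw [chainMap_zero_mk]
    refine mk_mem_supportedChains ?_
    simpa using c.empty_mem _
  | succ m ih => exact ih.comp_boundary.raise

lemma boundary_chainMap (m : ℕ) :
    boundary L m ∘ₗ c.chainMap (m + 1) = c.chainMap m ∘ₗ boundary K m := by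
  induction m with
  | zero => exact c.boundary_raise_zero _
  | succ m ih =>
    refine (chainMap_carries (m + 1)).comp_boundary.boundary_raise ?_
    rw [← LinearMap.comp_assoc, ih, LinearMap.comp_assoc, boundary_boundary, LinearMap.comp_zero]

/-! ### The homotopy -/

variable (c) in
/-- A chain homotopy carried by `c` between two chain maps carried by `c`. -/
def homotopy (f g : (m : ℕ) → Chain K m →ₗ[ℂ] Chain L m) :
    (m : ℕ) → Chain K m →ₗ[ℂ] Chain L (m + 1)
  | 0 => 0
  | m + 1 => c.raise (f (m + 1) - g (m + 1) - homotopy f g m ∘ₗ boundary K m)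

lemma homotopy_carries {f g : (m : ℕ) → Chain K m →ₗ[ℂ] Chain L m}
    (hf : ∀ m, c.Carries (f m)) (hg : ∀ m, c.Carries (g m)) (m : ℕ) :
    c.Carries (c.homotopy f g m) := by
  induction m with
  | zero => exact fun v => Submodule.zero_mem _
  | succ m ih => exact (((hf _).sub (hg _)).sub ih.comp_boundary).raise

lemma boundary_homotopy {f g : (m : ℕ) → Chain K m →ₗ[ℂ] Chain L m}
    (hf : ∀ m, c.Carries (f m)) (hg : ∀ m, c.Carries (g m)) (h0 : f 0 = g 0)
    (hf' : ∀ m, boundary L m ∘ₗ f (m + 1) = f m ∘ₗ boundary K m)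
    (hg' : ∀ m, boundary L m ∘ₗ g (m + 1) = g m ∘ₗ boundary K m) (m : ℕ) :
    boundary L (m + 1) ∘ₗ c.homotopy f g (m + 1) =
      f (m + 1) - g (m + 1) - c.homotopy f g m ∘ₗ boundary K m := by
  -- It remains to see that `f - g - h ∂` takes values in cycles. This follows from the identity one
  -- degree lower, and in the lowest degree from `h0`.
  refine (((hf _).sub (hg _)).sub (homotopy_carries hf hg m).comp_boundary).boundary_raise ?_
  rw [LinearMap.comp_sub, LinearMap.comp_sub, hf', hg', ← LinearMap.comp_assoc]
  cases m with
  | zero => simp [homotopy, h0]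
  | succ m =>
    rw [boundary_homotopy hf hg h0 hf' hg' m]
    simp only [LinearMap.sub_comp, LinearMap.comp_assoc, boundary_boundary]
    simp

lemma Carries.comp {U : Type} {M : AbstractSimplicialComplex U} [DecidableEq U] {d : Carrier L M}
    {e : Carrier K M} (h : ∀ s, ∀ w ∈ c.sub s, d.sub w ⊆ e.sub s) {m k l : ℕ}
    {f : Chain K m →ₗ[ℂ] Chain L k} {g : Chain L k →ₗ[ℂ] Chain M l} (hf : c.Carries f)
    (hg : d.Carries g) : e.Carries (g ∘ₗ f) := by
  intro v
  suffices h' : supportedChains L k (c.sub (Finset.univ.map v.1)) ≤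
      (supportedChains M l (e.sub (Finset.univ.map v.1))).comap g from h' (hf v)
  rw [supportedChains, Submodule.span_le]
  rintro _ ⟨w, hw, rfl⟩
  exact supportedChains_mono (h _ _ hw) (hg w)

/-! ### Equivariance -/

section Equivariance

variable {G : Type} [Group G] [MulAction G V] [MulAction G W] [IsSimplicialAction G K]
  [IsSimplicialAction G L]

/-- Only the apexes enter the definition of `raise`, so no equivariance of the subcomplexes is
needed. -/
lemma raise_equivariant
    (hc : ∀ (g : G) (s : Finset V), c.apexes (s.map (MulAction.toPerm g).toEmbedding) =
      (c.apexes s).map (MulAction.toPerm g).toEmbedding)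
    {m k : ℕ} {r : Chain K m →ₗ[ℂ] Chain L k} {g : G}
    (hr : r ∘ₗ chainAct m g = chainAct k g ∘ₗ r) :
    c.raise r ∘ₗ chainAct m g = chainAct (k + 1) g ∘ₗ c.raise r := by
  apply Chain.hom_ext
  intro v
  rw [LinearMap.comp_apply, LinearMap.comp_apply, chainAct_mk, raise_mk, raise_mk, map_act, hc,
    chainAct_avgCone, ← chainAct_mk]
  congr 1
  exact LinearMap.congr_fun hr _

lemma chainMap_equivariant
    (hc : ∀ (g : G) (s : Finset V), c.apexes (s.map (MulAction.toPerm g).toEmbedding) =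
      (c.apexes s).map (MulAction.toPerm g).toEmbedding) (m : ℕ) (g : G) :
    c.chainMap m ∘ₗ chainAct m g = chainAct m g ∘ₗ c.chainMap m := by
  induction m with
  | zero =>
    apply Chain.hom_ext
    intro v
    rw [LinearMap.comp_apply, LinearMap.comp_apply, chainAct_mk, chainMap_zero_mk,
      chainMap_zero_mk, chainAct_mk]
    congr 1
    exact (eq_emptySimplex _).symm
  | succ m ih =>
    refine raise_equivariant hc ?_
    have h : boundary K m ∘ₗ chainAct (m + 1) g = chainAct m g ∘ₗ boundary K m :=
      boundary_comm G K m g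
    rw [LinearMap.comp_assoc, h, ← LinearMap.comp_assoc, ih, LinearMap.comp_assoc]

lemma homotopy_equivariant
    (hc : ∀ (g : G) (s : Finset V), c.apexes (s.map (MulAction.toPerm g).toEmbedding) =
      (c.apexes s).map (MulAction.toPerm g).toEmbedding)
    {f f' : (m : ℕ) → Chain K m →ₗ[ℂ] Chain L m} {g : G}
    (hf : ∀ m, f m ∘ₗ chainAct m g = chainAct m g ∘ₗ f m)
    (hf' : ∀ m, f' m ∘ₗ chainAct m g = chainAct m g ∘ₗ f' m) (m : ℕ) :
    c.homotopy f f' m ∘ₗ chainAct m g = chainAct (m + 1) g ∘ₗ c.homotopy f f' m := by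
  induction m with
  | zero => simp [homotopy]
  | succ m ih =>
    refine raise_equivariant hc ?_
    have h : boundary K m ∘ₗ chainAct (m + 1) g = chainAct m g ∘ₗ boundary K m :=
      boundary_comm G K m g
    rw [LinearMap.sub_comp, LinearMap.sub_comp, LinearMap.comp_assoc, h, ← LinearMap.comp_assoc,
      ih, hf, hf']
    simp only [LinearMap.comp_sub, LinearMap.comp_assoc]

end Equivariance

end Carrier

/-! ### Equivariant chain maps and reduced homology -/

section Homology

variable (G : Type) [Group G] {V W U : Type} [MulAction G V] [MulAction G W] [MulAction G U]
  {K : AbstractSimplicialComplex V} {L : AbstractSimplicialComplex W}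
  {M : AbstractSimplicialComplex U}
  [IsSimplicialAction G K] [IsSimplicialAction G L] [IsSimplicialAction G M]

lemma augmentedChainComplex_d (m : ℕ) :
    (augmentedChainComplex G K).d (m + 1) m =
      (Rep.ofHom ⟨boundary K m, boundary_comm G K m⟩ :
        Rep.of (chainRep G K (m + 1)) ⟶ Rep.of (chainRep G K m)) :=
  ChainComplex.of_d (fun m => Rep.of (chainRep G K m))
    (fun m => Rep.ofHom ⟨boundary K m, boundary_comm G K m⟩) m

variable (K L) in
/-- An equivariant chain map between the augmented oriented chain complexes. -/
structure EquivariantChainMap where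
  /-- the components -/
  app : (m : ℕ) → Chain K m →ₗ[ℂ] Chain L m
  boundary_app : ∀ m, boundary L m ∘ₗ app (m + 1) = app m ∘ₗ boundary K m
  app_act : ∀ m (g : G), app m ∘ₗ chainAct m g = chainAct m g ∘ₗ app m

namespace EquivariantChainMap

variable {G}

/-- The corresponding morphism of complexes of representations. -/
def hom (f : EquivariantChainMap G K L) :
    augmentedChainComplex G K ⟶ augmentedChainComplex G L where
  f m := (Rep.ofHom ⟨f.app m, f.app_act m⟩ : Rep.of (chainRep G K m) ⟶ Rep.of (chainRep G L m))
  comm' i j hij := by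
    obtain rfl : j + 1 = i := hij
    rw [augmentedChainComplex_d, augmentedChainComplex_d]
    ext1
    apply Representation.IntertwiningMap.toLinearMap_injective
    exact f.boundary_app j

/-- The identity. -/
def id : EquivariantChainMap G K K where
  app _ := LinearMap.id
  boundary_app _ := rfl
  app_act _ _ := rfl

/-- The composition. -/
def comp (g : EquivariantChainMap G L M) (f : EquivariantChainMap G K L) :
    EquivariantChainMap G K M where
  app m := g.app m ∘ₗ f.app m
  boundary_app m := by
    rw [← LinearMap.comp_assoc, g.boundary_app, LinearMap.comp_assoc, f.boundary_app,
      LinearMap.comp_assoc]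
  app_act m a := by
    rw [LinearMap.comp_assoc, f.app_act, ← LinearMap.comp_assoc, g.app_act, LinearMap.comp_assoc]

lemma hom_id : (id : EquivariantChainMap G K K).hom = 𝟙 _ := rfl

lemma hom_comp (g : EquivariantChainMap G L M) (f : EquivariantChainMap G K L) :
    (g.comp f).hom = f.hom ≫ g.hom := rfl

/-- The components of a chain homotopy, as maps of representations. -/
def shiftHom (h : (m : ℕ) → Chain K m →ₗ[ℂ] Chain L (m + 1))
    (hact : ∀ m (a : G), h m ∘ₗ chainAct m a = chainAct (m + 1) a ∘ₗ h m) (i : ℕ) :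
    (augmentedChainComplex G K).X i ⟶ (augmentedChainComplex G L).X (i + 1) :=
  (Rep.ofHom ⟨h i, hact i⟩ : Rep.of (chainRep G K i) ⟶ Rep.of (chainRep G L (i + 1)))

/-- A family of equivariant linear maps `h` with `∂ h + h ∂ = f - g` is a chain homotopy. -/
def homotopy {f g : EquivariantChainMap G K L} (h : (m : ℕ) → Chain K m →ₗ[ℂ] Chain L (m + 1))
    (hact : ∀ m (a : G), h m ∘ₗ chainAct m a = chainAct (m + 1) a ∘ₗ h m)
    (h0 : boundary L 0 ∘ₗ h 0 = f.app 0 - g.app 0)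
    (hsucc : ∀ m, boundary L (m + 1) ∘ₗ h (m + 1) =
      f.app (m + 1) - g.app (m + 1) - h m ∘ₗ boundary K m) : Homotopy f.hom g.hom where
  hom i j := if e : i + 1 = j then
    shiftHom h hact i ≫ eqToHom (congrArg (augmentedChainComplex G L).X e) else 0
  zero i j hij := dif_neg fun e => hij e
  comm i := by
    cases i with
    | zero =>
      rw [Homotopy.dNext_zero_chainComplex, Homotopy.prevD_chainComplex, dif_pos rfl,
        eqToHom_refl, Category.comp_id, augmentedChainComplex_d]
      ext1
      apply Representation.IntertwiningMap.toLinearMap_injective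
      change f.app 0 = 0 + boundary L 0 ∘ₗ h 0 + g.app 0
      rw [h0]; abel
    | succ i =>
      rw [Homotopy.dNext_succ_chainComplex, Homotopy.prevD_chainComplex, dif_pos rfl, dif_pos rfl,
        eqToHom_refl, eqToHom_refl, Category.comp_id, Category.comp_id, augmentedChainComplex_d,
        augmentedChainComplex_d]
      ext1
      apply Representation.IntertwiningMap.toLinearMap_injective
      change f.app (i + 1) = h i ∘ₗ boundary K i + boundary L (i + 1) ∘ₗ h (i + 1) + g.app (i + 1)
      rw [hsucc]; abel

/-- The isomorphism in reduced homology induced by an isomorphism in homology. -/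
lemma nonempty_iso_of_quasiIsoAt (f : EquivariantChainMap G K L) (j : ℤ)
    (hf : 0 ≤ j + 1 → QuasiIsoAt f.hom (j + 1).toNat) :
    Nonempty (reducedHomology G K j ≅ reducedHomology G L j) := by
  by_cases hj : 0 ≤ j + 1
  · have := hf hj
    rw [reducedHomology, reducedHomology, if_pos hj, if_pos hj]
    exact ⟨isoOfQuasiIsoAt f.hom (j + 1).toNat⟩
  · rw [reducedHomology, reducedHomology, if_neg hj, if_neg hj]
    exact ⟨Iso.refl _⟩

/-- Homology in degree `m` involves three consecutive terms: it suffices that the map is epi in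
degree `m + 1`, iso in degree `m` and mono in the next lower degree. -/
lemma quasiIsoAt_of_bijective (f : EquivariantChainMap G K L) (m : ℕ)
    (hinj : ∀ k, Function.Injective (f.app k))
    (hsurj : ∀ k, m ≤ k → Function.Surjective (f.app k)) : QuasiIsoAt f.hom m := by
  rw [quasiIsoAt_iff]
  have hmono : ∀ k, Mono (f.hom.f k) := fun k => (Rep.mono_iff_injective _).2 (hinj k)
  have hepi : ∀ k, m ≤ k → Epi (f.hom.f k) := fun k hk =>
    (Rep.epi_iff_surjective _).2 (hsurj k hk)
  let φ := (HomologicalComplex.shortComplexFunctor (Rep.{0} ℂ G) (ComplexShape.down ℕ) m).map f.hom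
  have h1 : Epi φ.τ₁ := hepi _ (by rw [ChainComplex.prev]; omega)
  have h2 : IsIso φ.τ₂ := by
    have := hmono m
    have := hepi m le_rfl
    exact isIso_of_mono_of_epi (f.hom.f m)
  have h3 : Mono φ.τ₃ := hmono _
  exact ShortComplex.quasiIso_of_epi_of_isIso_of_mono φ

end EquivariantChainMap

end Homology

/-! ### Full subcomplexes -/

section FullSubcomplex

variable {V W : Type} {K : AbstractSimplicialComplex V} {L : AbstractSimplicialComplex W}
  {f : V ↪ W} (hf : ∀ s : Finset V, s ∈ K.faces ↔ s.map f ∈ L.faces)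

/-- The image of an ordered simplex. -/
def OrderedSimplex.map {m : ℕ} (v : OrderedSimplex K m) : OrderedSimplex L m :=
  ⟨v.1.trans f, by
    rw [← Finset.map_map]
    rcases v.2 with h | h
    · left; rw [h, Finset.map_empty]
    · exact Or.inr ((hf _).1 h)⟩

/-- The inclusion of a full subcomplex on oriented chains. -/
def includeChain (m : ℕ) : Chain K m →ₗ[ℂ] Chain L m :=
  Chain.lift (fun v => Chain.mk (v.map hf)) (fun v σ => Chain.mk_perm (v.map hf) σ)

lemma includeChain_mk {m : ℕ} (v : OrderedSimplex K m) :
    includeChain hf m (Chain.mk v) = Chain.mk (v.map hf) :=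
  Chain.lift_mk _ _ v

lemma OrderedSimplex.map_injective {m : ℕ} :
    Function.Injective (OrderedSimplex.map hf (m := m)) := by
  intro v w h
  apply Subtype.ext
  ext i
  apply f.injective
  exact DFunLike.congr_fun (congrArg Subtype.val h) i

-- A left inverse `r` keeps the simplices that come from `K` and sends all others to zero; being in
-- the image does not depend on the order of the vertices.
open Classical in
lemma includeChain_injective (m : ℕ) : Function.Injective (includeChain hf m) := by
  let r : OrderedSimplex L m → Chain K m := fun w =>
    if h : ∃ v : OrderedSimplex K m, v.map hf = w then Chain.mk h.choose else 0
  have hr : ∀ v : OrderedSimplex K m, r (v.map hf) = Chain.mk v := by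
    intro v
    have h : ∃ v' : OrderedSimplex K m, v'.map hf = v.map hf := ⟨v, rfl⟩
    simp only [r]
    rw [dif_pos h, OrderedSimplex.map_injective hf h.choose_spec]
  have hperm : ∀ w σ, r (w.perm σ) = ((Equiv.Perm.sign σ : ℤ) : ℂ) • r w := by
    intro w σ
    by_cases h : ∃ v : OrderedSimplex K m, v.map hf = w
    · obtain ⟨v, rfl⟩ := h
      rw [hr, ← Chain.mk_perm]
      exact hr (v.perm σ)
    · have h' : ¬ ∃ v : OrderedSimplex K m, v.map hf = w.perm σ := by
        rintro ⟨v, hv⟩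
        refine h ⟨v.perm σ⁻¹, ?_⟩
        apply Subtype.ext
        ext i
        have := DFunLike.congr_fun (congrArg Subtype.val hv) (σ⁻¹ i)
        change f (v.1 (σ⁻¹ i)) = _
        change f (v.1 (σ⁻¹ i)) = w.1 (σ (σ⁻¹ i)) at this
        rw [this]; simp
      simp only [r]
      rw [dif_neg h', dif_neg h, smul_zero]
  have hinv : Chain.lift r hperm ∘ₗ includeChain hf m = LinearMap.id := by
    apply Chain.hom_ext
    intro v
    rw [LinearMap.comp_apply, includeChain_mk, Chain.lift_mk, hr, LinearMap.id_apply]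
  exact Function.LeftInverse.injective (g := Chain.lift r hperm) (LinearMap.congr_fun hinv)

lemma includeChain_surjective {m : ℕ}
    (hm : ∀ s : Finset W, IsSimplex L s → s.card = m → ∀ x ∈ s, x ∈ Set.range f) :
    Function.Surjective (includeChain hf m) := by
  rw [← LinearMap.range_eq_top, eq_top_iff]
  rintro x -
  obtain ⟨x, rfl⟩ := Submodule.mkQ_surjective _ x
  induction x using Finsupp.induction_linear with
  | zero => exact Submodule.zero_mem _
  | add x y hx hy => rw [map_add]; exact Submodule.add_mem _ hx hy
  | single w a =>
    have hw : ∀ i, ∃ x, f x = w.1 i := fun i => hm _ w.2 (by simp) _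
      (Finset.mem_map_of_mem _ (Finset.mem_univ i))
    choose u hu using hw
    have hinj : Function.Injective u := fun i j hij => w.1.injective (by rw [← hu, ← hu, hij])
    have he : ((Finset.univ.map ⟨u, hinj⟩).map f) = Finset.univ.map w.1 := by
      rw [Finset.map_map]
      congr 1
      ext i
      exact hu i
    let v : OrderedSimplex K m := ⟨⟨u, hinj⟩, by
      rcases w.2 with h | h
      · rw [h, Finset.map_eq_empty] at he
        exact Or.inl he
      · exact Or.inr ((hf _).2 (he ▸ h))⟩
    have hv : v.map hf = w := by
      apply Subtype.ext
      ext i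
      exact hu i
    refine ⟨a • Chain.mk v, ?_⟩
    rw [map_smul, includeChain_mk, hv, Chain.mk, ← map_smul, Finsupp.smul_single, smul_eq_mul,
      mul_one]

/-- The inclusion of a full subcomplex. -/
def includeChainMap {G : Type} [Group G] [MulAction G V] [MulAction G W] [IsSimplicialAction G K]
    [IsSimplicialAction G L] (hG : ∀ (g : G) x, f (g • x) = g • f x) :
    EquivariantChainMap G K L where
  app := includeChain hf
  boundary_app m := by
    apply Chain.hom_ext
    intro v
    simp only [LinearMap.comp_apply, includeChain_mk, boundary_mk, map_sum, map_smul]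
    rfl
  app_act m g := by
    apply Chain.hom_ext
    intro v
    rw [LinearMap.comp_apply, LinearMap.comp_apply, chainAct_mk, includeChain_mk, includeChain_mk,
      chainAct_mk]
    congr 1
    apply Subtype.ext
    ext i
    exact hG g (v.1 i)

/-- The inclusion of a full subcomplex that contains all large simplices induces an isomorphism in
homology in high degrees. -/
theorem nonempty_reducedHomology_iso_of_full {G : Type} [Group G] [MulAction G V] [MulAction G W]
    [IsSimplicialAction G K] [IsSimplicialAction G L]
    (hf : ∀ s : Finset V, s ∈ K.faces ↔ s.map f ∈ L.faces) (hG : ∀ (g : G) x, f (g • x) = g • f x)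
    (j : ℤ)
    (hj : ∀ s : Finset W, IsSimplex L s → j + 1 ≤ s.card → ∀ x ∈ s, x ∈ Set.range f) :
    Nonempty (reducedHomology G K j ≅ reducedHomology G L j) := by
  refine (includeChainMap hf hG).nonempty_iso_of_quasiIsoAt j fun h => ?_
  refine EquivariantChainMap.quasiIsoAt_of_bijective _ _ (includeChain_injective hf) fun k hk => ?_
  refine includeChain_surjective hf fun s hs hsk => hj s hs ?_
  omega

end FullSubcomplex

/-- In degree 0 the chains are spanned by the empty simplex. This starts the homotopies between the
composites and the identities. -/
lemma Carrier.chainMap_zero_comp {V W : Type} {K : AbstractSimplicialComplex V}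
    {L : AbstractSimplicialComplex W} [DecidableEq V] [DecidableEq W] (c : Carrier K L)
    (d : Carrier L K) : d.chainMap 0 ∘ₗ c.chainMap 0 = LinearMap.id := by
  apply Chain.hom_ext
  intro v
  rw [LinearMap.comp_apply, chainMap_zero_mk, chainMap_zero_mk, LinearMap.id_apply,
    eq_emptySimplex v]

/-! ### Posets over the face poset of a simplicial complex -/

/-- A monotone map `carr` from a poset to the face poset of `K` such that the preimage of the faces
contained in a given face always has a greatest element. -/
structure ConicalFibers {V : Type} (K : AbstractSimplicialComplex V) (P : Type) [PartialOrder P]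
    where
  /-- the underlying map -/
  carr : P → Finset V
  mem_faces : ∀ E, carr E ∈ K.faces
  mono : ∀ E F, E ≤ F → carr E ⊆ carr F
  -- Taking `F = E` shows that `E` itself lies over `s`; the other direction says that it dominates
  -- the fiber.
  exists_greatest : ∀ s ∈ K.faces, ∃ E, ∀ F, F ≤ E ↔ carr F ⊆ s

lemma exists_greatest_of_isChain {P : Type} [PartialOrder P] {s : Finset P} (hs : s.Nonempty)
    (hc : IsChain (· ≤ ·) (s : Set P)) : ∃ E ∈ s, ∀ F ∈ s, F ≤ E := by
  obtain ⟨E, hE⟩ := s.exists_maximal hs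
  refine ⟨E, hE.1, fun F hF => ?_⟩
  rcases hc.total hF hE.1 with h | h
  · exact h
  · exact hE.2 hF h

namespace ConicalFibers

variable {V : Type} {K : AbstractSimplicialComplex V} {P : Type} [PartialOrder P] [Fintype P]
  [DecidableEq V] [DecidableEq P] (D : ConicalFibers K P)

open Classical in
/-- The set containing the greatest element of the fiber over `s`. -/
def greatest (s : Finset V) : Finset P := Finset.univ.filter fun E => ∀ F, F ≤ E ↔ D.carr F ⊆ s

-- By monotonicity the union is attained at the top element of the chain.
omit [Fintype P] [DecidableEq P] in
lemma biUnion_mem_faces {d : Finset P} (hd : d ∈ (orderComplex P).faces) :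
    d.biUnion D.carr ∈ K.faces := by
  obtain ⟨E, hEd, hE⟩ := exists_greatest_of_isChain hd.1 hd.2
  have h : d.biUnion D.carr = D.carr E :=
    (Finset.biUnion_subset.2 fun F hF => D.mono _ _ (hE F hF)).antisymm
      (Finset.subset_biUnion_of_mem D.carr hEd)
  rw [h]
  exact D.mem_faces E

/-- The carrier sending a face to the chains in the fiber over it. -/
def fiberCarrier : Carrier K (orderComplex P) where
  sub s := {d | IsChain (· ≤ ·) (d : Set P) ∧ ∀ F ∈ d, D.carr F ⊆ s}
  apexes := D.greatest
  apexes_nonempty s hs := by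
    obtain ⟨E, hE⟩ := D.exists_greatest s hs
    exact ⟨E, by simpa [greatest] using hE⟩
  isSimplex s _ d hd := by
    rcases d.eq_empty_or_nonempty with h | h
    · exact Or.inl h
    · exact Or.inr ⟨h, hd.1⟩
  insert_mem s _ E hE d hd := by
    have hE' : ∀ F, F ≤ E ↔ D.carr F ⊆ s := by simpa [greatest] using hE
    refine ⟨?_, ?_⟩
    · rw [Finset.coe_insert]
      -- The greatest element is comparable with the whole fiber, so it can be added to any chain in
      -- it.
      exact hd.1.insert fun F hF _ => Or.inr ((hE' F).2 (hd.2 F hF))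
    · intro F hF
      rcases Finset.mem_insert.1 hF with rfl | hF
      · exact (hE' F).1 le_rfl
      · exact hd.2 F hF
  mono s t hst d hd := ⟨hd.1, fun F hF => (hd.2 F hF).trans hst⟩
  empty_mem s := ⟨by simp, by simp⟩

/-- The carrier sending a chain to the subsets of the associated face. -/
def simplexCarrier : Carrier (orderComplex P) K where
  sub d := {w | w ⊆ d.biUnion D.carr}
  apexes d := d.biUnion D.carr
  apexes_nonempty _ hd := (K.isRelLowerSet_faces (D.biUnion_mem_faces hd)).1
  isSimplex _ hd _ hw := IsSimplex.mono (Or.inr (D.biUnion_mem_faces hd)) hw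
  insert_mem _ _ _ ha _ hw := Finset.insert_subset ha hw
  mono _ _ hst _ hw := Finset.Subset.trans hw (Finset.biUnion_subset_biUnion_of_subset_left _ hst)
  empty_mem _ := Finset.empty_subset _

/-- The carrier sending a face to its subsets. -/
def idCarrier (K : AbstractSimplicialComplex V) : Carrier K K where
  sub s := {w | w ⊆ s}
  apexes s := s
  apexes_nonempty _ hs := (K.isRelLowerSet_faces hs).1
  isSimplex _ hs _ hw := IsSimplex.mono (Or.inr hs) hw
  insert_mem _ _ _ ha _ hw := Finset.insert_subset ha hw
  mono _ _ hst _ hw := Finset.Subset.trans hw hst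
  empty_mem _ := Finset.empty_subset _

/-- The carrier sending a chain to the chains in the fiber over the associated face. -/
def saturatedCarrier : Carrier (orderComplex P) (orderComplex P) where
  sub d := D.fiberCarrier.sub (d.biUnion D.carr)
  apexes d := D.fiberCarrier.apexes (d.biUnion D.carr)
  apexes_nonempty _ hd := D.fiberCarrier.apexes_nonempty _ (D.biUnion_mem_faces hd)
  isSimplex _ hd := D.fiberCarrier.isSimplex _ (D.biUnion_mem_faces hd)
  insert_mem _ hd := D.fiberCarrier.insert_mem _ (D.biUnion_mem_faces hd)
  mono _ _ hst := D.fiberCarrier.mono _ _ (Finset.biUnion_subset_biUnion_of_subset_left _ hst)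
  empty_mem _ := D.fiberCarrier.empty_mem _

section Action

variable {G : Type} [Group G] [MulAction G V] [MulAction G P]

omit [Fintype P] [DecidableEq P] in
lemma biUnion_map (hcarr : ∀ (g : G) E,
      D.carr (g • E) = (D.carr E).map (MulAction.toPerm g).toEmbedding) (g : G) (d : Finset P) :
    (d.map (MulAction.toPerm g).toEmbedding).biUnion D.carr =
      (d.biUnion D.carr).map (MulAction.toPerm g).toEmbedding := by
  ext x
  simp only [Finset.mem_biUnion, Finset.mem_map]
  constructor
  · rintro ⟨_, ⟨E, hE, rfl⟩, hx⟩
    rw [show (MulAction.toPerm g).toEmbedding E = g • E from rfl, hcarr, Finset.mem_map] at hx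
    obtain ⟨y, hy, rfl⟩ := hx
    exact ⟨y, ⟨E, hE, hy⟩, rfl⟩
  · rintro ⟨y, ⟨E, hE, hy⟩, rfl⟩
    refine ⟨_, ⟨E, hE, rfl⟩, ?_⟩
    rw [show (MulAction.toPerm g).toEmbedding E = g • E from rfl, hcarr]
    exact Finset.mem_map_of_mem _ hy

-- Each `g` acts by order automorphisms compatible with `carr`, hence carries the greatest element
-- of one fiber to that of another. The reverse inclusion uses `g⁻¹`.
omit [DecidableEq P] in
lemma greatest_map (hle : ∀ (g : G) (E F : P), E ≤ F → g • E ≤ g • F)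
    (hcarr : ∀ (g : G) E, D.carr (g • E) = (D.carr E).map (MulAction.toPerm g).toEmbedding)
    (g : G) (s : Finset V) :
    D.greatest (s.map (MulAction.toPerm g).toEmbedding) =
      (D.greatest s).map (MulAction.toPerm g).toEmbedding := by
  have h : ∀ (g : G) (s : Finset V) E, (∀ F, F ≤ E ↔ D.carr F ⊆ s) →
      ∀ F, F ≤ g • E ↔ D.carr F ⊆ s.map (MulAction.toPerm g).toEmbedding := by
    intro g s E hE F
    obtain ⟨F, rfl⟩ : ∃ F', F = g • F' := ⟨g⁻¹ • F, by simp⟩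
    rw [hcarr, Finset.map_subset_map, ← hE]
    refine ⟨fun h => ?_, hle g F E⟩
    simpa using hle g⁻¹ _ _ h
  ext E
  simp only [greatest, Finset.mem_filter_univ, Finset.mem_map]
  constructor
  · intro hE
    refine ⟨g⁻¹ • E, ?_, smul_inv_smul g E⟩
    have := h g⁻¹ _ E hE
    rw [Finset.map_map] at this
    convert this using 4
    ext x
    simp
  · rintro ⟨E, hE, rfl⟩
    exact h g s E hE

end Action

end ConicalFibers

/-- A form of Quillen's fiber lemma. -/
theorem nonempty_reducedHomology_iso_of_conicalFibers {V : Type} {K : AbstractSimplicialComplex V}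
    {P : Type} [PartialOrder P] [Finite P] (D : ConicalFibers K P) {G : Type} [Group G]
    [MulAction G V] [MulAction G P] [IsSimplicialAction G K] [IsSimplicialAction G (orderComplex P)]
    (hle : ∀ (g : G) (E F : P), E ≤ F → g • E ≤ g • F)
    (hcarr : ∀ (g : G) E, D.carr (g • E) = (D.carr E).map (MulAction.toPerm g).toEmbedding)
    (j : ℤ) :
    Nonempty (reducedHomology G (orderComplex P) j ≅ reducedHomology G K j) := by
  classical
  have := Fintype.ofFinite P
  let φ : EquivariantChainMap G K (orderComplex P) :=
    ⟨D.fiberCarrier.chainMap, Carrier.boundary_chainMap,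
      Carrier.chainMap_equivariant (D.greatest_map hle hcarr)⟩
  let ψ : EquivariantChainMap G (orderComplex P) K :=
    ⟨D.simplexCarrier.chainMap, Carrier.boundary_chainMap,
      Carrier.chainMap_equivariant (D.biUnion_map hcarr)⟩
  -- Each composite shares a carrier with the identity and agrees with it in degree 0, hence is
  -- homotopic to it. For `φ ∘ ψ` the carrier consists of the chains in the fiber over the union of
  -- `carr` along the given chain; that chain is one of them.
  have h1 : ∀ m, (ConicalFibers.idCarrier K).Carries ((ψ.comp φ).app m) := fun m =>
    Carrier.Carries.comp (c := D.fiberCarrier) (d := D.simplexCarrier)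
      (e := ConicalFibers.idCarrier K) (fun s d hd w hw => Finset.Subset.trans hw
      (Finset.biUnion_subset.2 hd.2)) (Carrier.chainMap_carries m) (Carrier.chainMap_carries m)
  have h2 : ∀ m, (ConicalFibers.idCarrier K).Carries
      ((EquivariantChainMap.id : EquivariantChainMap G K K).app m) := fun m v =>
    mk_mem_supportedChains (Finset.Subset.refl _)
  have h3 : ∀ m, D.saturatedCarrier.Carries ((φ.comp ψ).app m) := fun m =>
    Carrier.Carries.comp (c := D.simplexCarrier) (d := D.fiberCarrier) (e := D.saturatedCarrier)
      (fun s w hw => D.fiberCarrier.mono _ _ hw)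
      (Carrier.chainMap_carries m) (Carrier.chainMap_carries m)
  have h4 : ∀ m, D.saturatedCarrier.Carries
      ((EquivariantChainMap.id : EquivariantChainMap G (orderComplex P) _).app m) := fun m v =>
    mk_mem_supportedChains ⟨by
      rcases v.2 with h | h
      · rw [h]; simp
      · exact h.2, fun F hF => Finset.subset_biUnion_of_mem D.carr hF⟩
  have h5 : (ψ.comp φ).app 0 = (EquivariantChainMap.id : EquivariantChainMap G K K).app 0 :=
    Carrier.chainMap_zero_comp D.fiberCarrier D.simplexCarrier
  have h6 : (φ.comp ψ).app 0 =
      (EquivariantChainMap.id : EquivariantChainMap G (orderComplex P) _).app 0 :=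
    Carrier.chainMap_zero_comp D.simplexCarrier D.fiberCarrier
  let e : HomotopyEquiv (augmentedChainComplex G K) (augmentedChainComplex G (orderComplex P)) :=
    { hom := φ.hom
      inv := ψ.hom
      homotopyHomInvId := by
        rw [← EquivariantChainMap.hom_comp, ← EquivariantChainMap.hom_id]
        refine EquivariantChainMap.homotopy ((ConicalFibers.idCarrier K).homotopy _ _)
          (fun m g => Carrier.homotopy_equivariant (fun _ _ => rfl) (fun k => (ψ.comp φ).app_act k g)
            (fun k => EquivariantChainMap.id.app_act k g) m) ?_
          (Carrier.boundary_homotopy h1 h2 h5 (ψ.comp φ).boundary_app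
            (EquivariantChainMap.id (G := G)).boundary_app)
        rw [h5, sub_self]
        exact LinearMap.comp_zero _
      homotopyInvHomId := by
        rw [← EquivariantChainMap.hom_comp, ← EquivariantChainMap.hom_id]
        refine EquivariantChainMap.homotopy (D.saturatedCarrier.homotopy _ _)
          (fun m g => Carrier.homotopy_equivariant (fun g s => ?_) (fun k => (φ.comp ψ).app_act k g)
            (fun k => EquivariantChainMap.id.app_act k g) m) ?_
          (Carrier.boundary_homotopy h3 h4 h6 (φ.comp ψ).boundary_app
            (EquivariantChainMap.id (G := G)).boundary_app)
        · refine Eq.trans ?_ (D.greatest_map hle hcarr g _)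
          exact congrArg D.greatest (D.biUnion_map hcarr g s)
        · rw [h6, sub_self]
          exact LinearMap.comp_zero _ }
  exact ψ.nonempty_iso_of_quasiIsoAt j fun _ => e.quasiIsoAt_inv _

/-! ### Prime cycles -/

section Cycle

variable {α : Type} [Fintype α] [DecidableEq α]

/-- A permutation that commutes with a cycle of prime order and moves a point of its support acts
as a power of this cycle on its support. -/
lemma zpowers_cycleOf_eq_of_commute {p : ℕ} (hp : p.Prime) {a e : Equiv.Perm α} (ha : a.IsCycle)
    (hap : a.support.card = p) (hc : Commute e a) {x : α} (hx : a x ≠ x) (hex : e x ≠ x) :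
    Subgroup.zpowers (e.cycleOf x) = Subgroup.zpowers a := by
  have hc' : ∀ y, e (a y) = a (e y) := fun y => Equiv.Perm.ext_iff.1 hc y
  have hex' : a (e x) ≠ e x := by
    rw [← hc']
    exact fun h => hx (e.injective h)
  obtain ⟨i, hi, hi'⟩ := (ha.sameCycle hx hex').exists_pow_eq'
  have hi0 : 0 < i := by
    rcases Nat.eq_zero_or_pos i with rfl | h
    · exact absurd hi'.symm hex
    · exact h
  have hord : orderOf a = p := by rw [ha.orderOf, hap]
  have hcyc : (a ^ i).IsCycle := ha.isCycle_pow_pos_of_lt_prime_order (hord ▸ hp) i hi0 hi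
  have hsupp : (a ^ i).support = a.support := ha.support_pow_of_pos_of_lt_orderOf hi0 hi
  -- `e` and `a ^ i` agree at `x` and both commute with `a`, which is transitive on its support; so
  -- they agree on that support.
  have hmem : a ^ i ∈ e.cycleFactorsFinset := by
    rw [Equiv.Perm.mem_cycleFactorsFinset_iff]
    refine ⟨hcyc, fun y hy => ?_⟩
    rw [hsupp, Equiv.Perm.mem_support] at hy
    obtain ⟨k, rfl⟩ := ha.exists_pow_eq hx hy
    have h : e * a ^ k = a ^ k * e := (hc.pow_right k)
    have h' : a ^ i * a ^ k = a ^ k * a ^ i := by rw [← pow_add, ← pow_add, add_comm]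
    rw [← Equiv.Perm.mul_apply, ← Equiv.Perm.mul_apply, h, h', Equiv.Perm.mul_apply,
      Equiv.Perm.mul_apply, hi']
  have heq : a ^ i = e.cycleOf x :=
    (Equiv.Perm.eq_cycleOf_of_mem_cycleFactorsFinset_iff e _ hmem x).2
      (by rwa [hsupp, Equiv.Perm.mem_support])
  rw [← heq]
  refine Subgroup.eq_of_le_of_card_ge ?_ ?_
  · rw [Subgroup.zpowers_le]
    exact Subgroup.npow_mem_zpowers a i
  · rw [Nat.card_zpowers, Nat.card_zpowers, ha.orderOf, hcyc.orderOf, hsupp]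

/-- The length of a cycle divides the order of `e`, hence `p`, and is at least 2. -/
lemma card_support_of_mem_cycleFactorsFinset {p : ℕ} (hp : p.Prime) {e c : Equiv.Perm α}
    (he : e ^ p = 1) (hc : c ∈ e.cycleFactorsFinset) : c.support.card = p := by
  have h1 : c.support.card ∈ e.cycleType := by
    rw [Equiv.Perm.cycleType_def]
    exact Multiset.mem_map_of_mem (Finset.card ∘ Equiv.Perm.support) hc
  have h2 := (Equiv.Perm.dvd_of_mem_cycleType h1).trans (orderOf_dvd_of_pow_eq_one he)
  have h3 := Equiv.Perm.two_le_of_mem_cycleType h1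
  rcases (Nat.dvd_prime hp).1 h2 with h | h
  · omega
  · exact h

end Cycle

lemma commute_of_isMulCommutative {G : Type} [Group G] {H : Subgroup G} (h : IsMulCommutative H)
    {x y : G} (hx : x ∈ H) (hy : y ∈ H) : Commute x y :=
  congrArg Subtype.val (h.is_comm.comm ⟨x, hx⟩ ⟨y, hy⟩)

/-- A subgroup is abelian when it lies in its own centralizer; the symmetry of this relation allows
reduction to generators on both sides. -/
lemma isMulCommutative_biSup {G ι : Type} [Group G] {s : Finset ι} {H : ι → Subgroup G}
    (h : ∀ i ∈ s, ∀ j ∈ s, ∀ x ∈ H i, ∀ y ∈ H j, Commute x y) :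
    IsMulCommutative ↥(⨆ i ∈ s, H i) := by
  rw [← Subgroup.le_centralizer_iff_isMulCommutative]
  refine iSup₂_le fun i hi => ?_
  rw [Subgroup.le_centralizer_iff]
  refine iSup₂_le fun j hj => ?_
  intro y hy
  rw [Subgroup.mem_centralizer_iff]
  exact fun x hx => h i hi j hj x hx y hy

lemma pow_eq_one_of_mem_biSup {G ι : Type} [Group G] {s : Finset ι} {H : ι → Subgroup G} {p : ℕ}
    (h : IsMulCommutative ↥(⨆ i ∈ s, H i)) (hH : ∀ i ∈ s, ∀ x ∈ H i, x ^ p = 1) {x : G}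
    (hx : x ∈ ⨆ i ∈ s, H i) : x ^ p = 1 := by
  let N : Subgroup G :=
    { carrier := {x | x ∈ (⨆ i ∈ s, H i) ∧ x ^ p = 1}
      mul_mem' := fun {a b} ha hb => ⟨mul_mem ha.1 hb.1, by
        rw [(commute_of_isMulCommutative h ha.1 hb.1).mul_pow, ha.2, hb.2, one_mul]⟩
      one_mem' := ⟨one_mem _, one_pow p⟩
      inv_mem' := fun {a} ha => ⟨inv_mem ha.1, by rw [inv_pow, ha.2, inv_one]⟩ }
  have hN : (⨆ i ∈ s, H i) ≤ N :=
    iSup₂_le fun i hi x hx => ⟨(le_biSup H hi : H i ≤ ⨆ i ∈ s, H i) hx, hH i hi x hx⟩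
  exact (hN hx).2

/-! ### The cycles occurring in a subgroup -/

section Carr

variable {p n : ℕ}

open Classical in
/-- The subgroups generated by a `p`-cycle that is a cycle factor of an element of `E`. -/
def cycleSet (p : ℕ) {n : ℕ} (E : Subgroup (Equiv.Perm (Fin n))) : Finset (CycleSubgroups p n) :=
  have : Fintype (CycleSubgroups p n) := Fintype.ofFinite _
  Finset.univ.filter fun H => ∃ e ∈ E, ∃ c ∈ e.cycleFactorsFinset, H.1 = Subgroup.zpowers c

lemma mem_cycleSet {E : Subgroup (Equiv.Perm (Fin n))} {H : CycleSubgroups p n} :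
    H ∈ cycleSet p E ↔ ∃ e ∈ E, ∃ c ∈ e.cycleFactorsFinset, H.1 = Subgroup.zpowers c := by
  simp [cycleSet]

lemma cycleSet_mono {E F : Subgroup (Equiv.Perm (Fin n))} (h : E ≤ F) :
    cycleSet p E ⊆ cycleSet p F := by
  intro H
  rw [mem_cycleSet, mem_cycleSet]
  rintro ⟨e, he, c, hc, h'⟩
  exact ⟨e, h he, c, hc, h'⟩

lemma smul_mem_cycleSet {E : Subgroup (Equiv.Perm (Fin n))} {H : CycleSubgroups p n}
    (g : Equiv.Perm (Fin n)) (h : H ∈ cycleSet p E) :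
    g • H ∈ cycleSet p (E.map (MulAut.conj g).toMonoidHom) := by
  rw [mem_cycleSet] at h ⊢
  obtain ⟨e, he, c, hc, h'⟩ := h
  refine ⟨g * e * g⁻¹, ⟨e, he, rfl⟩, g * c * g⁻¹, ?_, ?_⟩
  · rwa [Equiv.Perm.mem_cycleFactorsFinset_conj]
  · change H.1.map (MulAut.conj g).toMonoidHom = _
    rw [h', MonoidHom.map_zpowers]
    rfl

lemma cycleSet_map_conj (E : Subgroup (Equiv.Perm (Fin n))) (g : Equiv.Perm (Fin n)) :
    cycleSet p (E.map (MulAut.conj g).toMonoidHom) =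
      (cycleSet p E).map (MulAction.toPerm g).toEmbedding := by
  ext H
  rw [Finset.mem_map]
  constructor
  · intro h
    refine ⟨g⁻¹ • H, ?_, smul_inv_smul g H⟩
    have := smul_mem_cycleSet g⁻¹ h
    rwa [← map_conj_mul, inv_mul_cancel, map_conj_one] at this
  · rintro ⟨H, h, rfl⟩
    exact smul_mem_cycleSet g h

lemma exists_mem_cycleSet (hp : p.Prime) {E : Subgroup (Equiv.Perm (Fin n))}
    (hE : ∀ x ∈ E, x ^ p = 1) {e c : Equiv.Perm (Fin n)} (he : e ∈ E)
    (hc : c ∈ e.cycleFactorsFinset) : ∃ H ∈ cycleSet p E, H.1 = Subgroup.zpowers c :=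
  ⟨⟨Subgroup.zpowers c, c, (Equiv.Perm.mem_cycleFactorsFinset_iff.1 hc).1,
    card_support_of_mem_cycleFactorsFinset hp (hE e he) hc, rfl⟩,
    mem_cycleSet.2 ⟨e, he, c, hc, rfl⟩, rfl⟩

lemma cycleSet_nonempty (hp : p.Prime) {E : Subgroup (Equiv.Perm (Fin n))}
    (hE : IsNontrivialElementaryAbelian p E) : (cycleSet p E).Nonempty := by
  obtain ⟨⟨e, he⟩, he1⟩ := E.ne_bot_iff_exists_ne_one.1 hE.1
  have h : e.cycleFactorsFinset.Nonempty := by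
    rw [Finset.nonempty_iff_ne_empty, Ne, Equiv.Perm.cycleFactorsFinset_eq_empty_iff]
    exact fun h => he1 (Subtype.ext h)
  obtain ⟨c, hc⟩ := h
  obtain ⟨H, hH, -⟩ := exists_mem_cycleSet hp hE.2.2 he hc
  exact ⟨H, hH⟩

/-- Every permutation is the product of its cycles, which here are `p`-cycles. -/
lemma le_biSup_cycleSet (hp : p.Prime) {E : Subgroup (Equiv.Perm (Fin n))}
    (hE : ∀ x ∈ E, x ^ p = 1) : E ≤ ⨆ H ∈ cycleSet p E, H.1 := by
  intro e he
  rw [← Equiv.Perm.cycleFactorsFinset_noncommProd e]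
  refine Subgroup.noncommProd_mem _ _ fun c hc => ?_
  obtain ⟨H, hH, h⟩ := exists_mem_cycleSet hp hE he hc
  refine (le_biSup (fun H : CycleSubgroups p n => H.1) hH :
    H.1 ≤ ⨆ H ∈ cycleSet p E, H.1) ?_
  rw [h]
  exact Subgroup.mem_zpowers c

lemma pow_eq_one_of_mem_cycleSubgroup (H : CycleSubgroups p n) {x : Equiv.Perm (Fin n)}
    (hx : x ∈ H.1) : x ^ p = 1 := by
  obtain ⟨c, h1, h2, h3⟩ := H.2
  rw [h3] at hx
  obtain ⟨k, rfl⟩ := hx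
  have : c ^ p = 1 := by rw [← h2, ← h1.orderOf, pow_orderOf_eq_one]
  change (c ^ k) ^ p = 1
  rw [← zpow_natCast, ← zpow_mul, mul_comm, zpow_mul, zpow_natCast, this, one_zpow]

/-- The cycles occurring in the group generated by a face of the cycle complex. -/
lemma cycleSet_biSup (hp : p.Prime) {s : Finset (CycleSubgroups p n)}
    (hs : IsMulCommutative ↥(⨆ H ∈ s, H.1)) : cycleSet p (⨆ H ∈ s, H.1) = s := by
  ext C
  rw [mem_cycleSet]
  have hle : ∀ H ∈ s, H.1 ≤ ⨆ H ∈ s, H.1 := fun H hH =>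
    le_biSup (fun H : CycleSubgroups p n => H.1) hH
  constructor
  · rintro ⟨e, he, c, hc, hC⟩
    obtain ⟨x, hx⟩ : ∃ x, x ∈ c.support := by
      rw [← Finset.nonempty_def, Finset.nonempty_iff_ne_empty, Ne, Equiv.Perm.support_eq_empty_iff]
      exact (Equiv.Perm.mem_cycleFactorsFinset_iff.1 hc).1.ne_one
    have hcx := (Equiv.Perm.eq_cycleOf_of_mem_cycleFactorsFinset_iff e c hc x).2 hx
    have hex : e x ≠ x := by
      rw [← (Equiv.Perm.mem_cycleFactorsFinset_iff.1 hc).2 x hx]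
      exact Equiv.Perm.mem_support.1 hx
    -- If every member of `s` fixed `x`, so would the group they generate, and `e` with it.
    obtain ⟨H, hH, hHx⟩ : ∃ H ∈ s, ¬ H.1 ≤ MulAction.stabilizer (Equiv.Perm (Fin n)) x := by
      by_contra! h
      exact hex ((iSup₂_le h : (⨆ H ∈ s, H.1) ≤ _) he)
    obtain ⟨a, ha1, ha2, ha3⟩ := H.2
    have hax : a x ≠ x := by
      intro h
      refine hHx ?_
      rw [ha3, Subgroup.zpowers_le]
      exact h
    have hcomm : Commute e a := commute_of_isMulCommutative hs he
      (hle H hH (ha3 ▸ Subgroup.mem_zpowers a))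
    have := zpowers_cycleOf_eq_of_commute hp ha1 ha2 hcomm hax hex
    rw [← hcx, ← hC, ← ha3] at this
    rwa [Subtype.ext this]
  · intro hC
    obtain ⟨a, ha1, ha2, ha3⟩ := C.2
    refine ⟨a, hle C hC (ha3 ▸ Subgroup.mem_zpowers a), a, ?_, ha3⟩
    rw [Equiv.Perm.mem_cycleFactorsFinset_iff]
    exact ⟨ha1, fun _ _ => rfl⟩

lemma isNontrivialElementaryAbelian_biSup {s : Finset (CycleSubgroups p n)}
    (hs : s ∈ (cycleComplex p n).faces) :
    IsNontrivialElementaryAbelian p (⨆ H ∈ s, H.1) := by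
  refine ⟨?_, hs.2, fun x hx => pow_eq_one_of_mem_biSup hs.2
    (fun H _ y hy => pow_eq_one_of_mem_cycleSubgroup H hy) hx⟩
  obtain ⟨H, hH⟩ := hs.1
  intro h
  have hle : H.1 ≤ ⨆ H ∈ s, H.1 := le_biSup (fun H : CycleSubgroups p n => H.1) hH
  rw [h, le_bot_iff] at hle
  obtain ⟨a, ha1, -, ha3⟩ := H.2
  rw [hle, eq_comm, Subgroup.zpowers_eq_bot] at ha3
  exact ha1.ne_one ha3

/-! ### The subgroups whose cycles commute -/

/-- The nontrivial elementary abelian subgroups such that the cycles of all their elements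
commute. -/
abbrev CommutingCycleSubgroups (p n : ℕ) : Type :=
  {E : ElementaryAbelianSubgroups p (Equiv.Perm (Fin n)) //
    cycleSet p E.1 ∈ (cycleComplex p n).faces}

instance : MulAction (Equiv.Perm (Fin n)) (CommutingCycleSubgroups p n) where
  smul g E := ⟨g • E.1, by
    change cycleSet p (E.1.1.map (MulAut.conj g).toMonoidHom) ∈ _
    rw [cycleSet_map_conj]
    exact IsSimplicialAction.smul_mem g _ E.2⟩
  one_smul E := Subtype.ext (one_smul _ E.1)
  mul_smul g h E := Subtype.ext (mul_smul g h E.1)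

lemma smul_le_smul_commutingCycleSubgroups (g : Equiv.Perm (Fin n))
    (E F : CommutingCycleSubgroups p n) (h : E ≤ F) : g • E ≤ g • F :=
  Subgroup.map_mono (f := (MulAut.conj g).toMonoidHom) (show E.1.1 ≤ F.1.1 from h)

instance : IsSimplicialAction (Equiv.Perm (Fin n))
    (orderComplex (CommutingCycleSubgroups p n)) where
  smul_mem g s hs := by
    refine ⟨hs.1.map, ?_⟩
    intro x hx y hy hxy
    rw [Finset.mem_coe, Finset.mem_map] at hx hy
    obtain ⟨x, hx, rfl⟩ := hx
    obtain ⟨y, hy, rfl⟩ := hy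
    rcases hs.2.total hx hy with h | h
    · exact Or.inl (smul_le_smul_commutingCycleSubgroups g _ _ h)
    · exact Or.inr (smul_le_smul_commutingCycleSubgroups g _ _ h)

/-- The map that sends a subgroup to its set of cycles. -/
def cycleFibers (hp : p.Prime) (n : ℕ) :
    ConicalFibers (cycleComplex p n) (CommutingCycleSubgroups p n) where
  carr E := cycleSet p E.1.1
  mem_faces E := E.2
  mono E F h := cycleSet_mono h
  exists_greatest s hs := by
    -- The greatest element of the fiber over `s` is the group generated by `s`.
    refine ⟨⟨⟨⨆ H ∈ s, H.1, isNontrivialElementaryAbelian_biSup hs⟩, ?_⟩, fun F => ⟨?_, ?_⟩⟩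
    · rw [cycleSet_biSup hp hs.2]
      exact hs
    · intro h
      exact (cycleSet_mono h).trans (cycleSet_biSup hp hs.2).subset
    · intro h
      exact (le_biSup_cycleSet hp F.1.2.2.2).trans (biSup_mono fun _ hH => h hH)

theorem nonempty_reducedHomology_commutingCycleSubgroups_iso (hp : p.Prime) (n : ℕ) (j : ℤ) :
    Nonempty (reducedHomology (Equiv.Perm (Fin n)) (orderComplex (CommutingCycleSubgroups p n)) j ≅
      reducedHomology (Equiv.Perm (Fin n)) (cycleComplex p n) j) :=
  nonempty_reducedHomology_iso_of_conicalFibers (cycleFibers hp n)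
    smul_le_smul_commutingCycleSubgroups (fun g E => cycleSet_map_conj E.1.1 g) j

/-- Comparison of the Quillen complex with the subcomplex of subgroups with commuting cycles. -/
theorem nonempty_reducedHomology_commutingCycleSubgroups_iso_quillenComplex (p n : ℕ) (j : ℤ)
    (hj : ∀ s : Finset (ElementaryAbelianSubgroups p (Equiv.Perm (Fin n))),
      IsSimplex (quillenComplex p (Equiv.Perm (Fin n))) s → j + 1 ≤ s.card → ∀ E ∈ s,
        cycleSet p E.1 ∈ (cycleComplex p n).faces) :
    Nonempty (reducedHomology (Equiv.Perm (Fin n)) (orderComplex (CommutingCycleSubgroups p n)) j ≅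
      reducedHomology (Equiv.Perm (Fin n)) (quillenComplex p (Equiv.Perm (Fin n))) j) := by
  refine nonempty_reducedHomology_iso_of_full (f := Function.Embedding.subtype _) (fun s => ?_)
    (fun _ _ => rfl) j fun s hs hsj E hE => ⟨⟨E, hj s hs hsj E hE⟩, rfl⟩
  constructor
  · intro hs
    refine ⟨hs.1.map, ?_⟩
    intro x hx y hy _
    rw [Finset.mem_coe, Finset.mem_map] at hx hy
    obtain ⟨x, hx, rfl⟩ := hx
    obtain ⟨y, hy, rfl⟩ := hy
    exact hs.2.total hx hy
  · intro hs
    refine ⟨Finset.map_nonempty.1 hs.1, ?_⟩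
    intro x hx y hy _
    exact hs.2.total (Finset.mem_map_of_mem _ hx) (Finset.mem_map_of_mem _ hy)

end Carr

/-! ### Ranks of elementary abelian subgroups of the symmetric group -/

/-- An orbit of size `p ^ a` contributes at most `a` to the rank and so uses at least `p` points per
unit of rank. -/
lemma mul_le_pow_of_prime {p : ℕ} (hp : p.Prime) (a : ℕ) : p * a ≤ p ^ a := by
  cases a with
  | zero => simp
  | succ a =>
    rw [pow_succ', Nat.mul_le_mul_left_iff hp.pos]
    exact Nat.lt_pow_self hp.one_lt

/-- Here an orbit of size `p ^ (a + 2)` uses `p * (p - 2)` points more than `p` per unit of rank.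
Equality holds at `a = 0`, and after division by `p` the right side grows by at least 1 in each
step. -/
lemma mul_add_le_pow_of_prime {p : ℕ} (hp : p.Prime) (a : ℕ) :
    p * (a + p) ≤ p ^ (a + 2) := by
  rw [pow_succ', Nat.mul_le_mul_left_iff hp.pos]
  induction a with
  | zero => simp
  | succ a ih =>
    have h1 : p ^ (a + 1) < p ^ (a + 1 + 1) := Nat.pow_lt_pow_right hp.one_lt (Nat.lt_succ_self _)
    omega

section Orbits

variable {p n : ℕ}

lemma IsNontrivialElementaryAbelian.isPGroup {G : Type} [Group G] {E : Subgroup G}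
    (hE : IsNontrivialElementaryAbelian p E) : IsPGroup p E := fun x => ⟨1, by
  rw [pow_one]
  exact Subtype.ext (hE.2.2 x.1 x.2)⟩

/-- An abelian permutation group embeds in the product of its orbits. -/
lemma card_le_prod_card_orbit {E : Subgroup (Equiv.Perm (Fin n))} (hE : IsMulCommutative E)
    [Fintype (MulAction.orbitRel.Quotient E (Fin n))] :
    Nat.card E ≤ ∏ ω : MulAction.orbitRel.Quotient E (Fin n),
      Nat.card (MulAction.orbit E (Quotient.out ω)) := by
  rw [← Nat.card_pi]
  let f : E → (ω : MulAction.orbitRel.Quotient E (Fin n)) → MulAction.orbit E (Quotient.out ω) :=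
    fun e ω => ⟨e • Quotient.out ω, MulAction.mem_orbit _ _⟩
  refine Nat.card_le_card_of_injective f ?_
  intro e e' h
  apply Subtype.ext
  ext1 x
  let ω : MulAction.orbitRel.Quotient E (Fin n) := Quotient.mk'' x
  obtain ⟨g, hg⟩ : x ∈ MulAction.orbit E (Quotient.out ω) := by
    rw [← MulAction.orbitRel_apply]
    exact (MulAction.orbitRel E (Fin n)).symm (Quotient.mk_out (s := MulAction.orbitRel E (Fin n)) x)
  have h1 : e • Quotient.out ω = e' • Quotient.out ω := congrArg Subtype.val (congrFun h ω)
  -- Since `E` is abelian, the action of an element on an orbit is determined by its value at one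
  -- point.
  have h2 : ∀ e : E, e • x = g • e • Quotient.out ω := by
    intro e
    rw [← hg, smul_smul, smul_smul, hE.is_comm.comm]
  change e • x = e' • x
  rw [h2, h2, h1]

/-- The rank of an elementary abelian subgroup of the symmetric group. -/
lemma exists_card_eq_pow (hp : p.Prime) {E : Subgroup (Equiv.Perm (Fin n))}
    (hE : IsNontrivialElementaryAbelian p E) :
    ∃ r, Nat.card E = p ^ r ∧ p * r ≤ n ∧
      ((∃ x : Fin n, p < Nat.card (MulAction.orbit E x)) → p * (r + p) ≤ n + p * 2) := by
  classical
  have := Fact.mk hp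
  have := Fintype.ofFinite (MulAction.orbitRel.Quotient E (Fin n))
  obtain ⟨r, hr⟩ := IsPGroup.iff_card.1 hE.isPGroup
  choose a ha using fun ω : MulAction.orbitRel.Quotient E (Fin n) =>
    hE.isPGroup.card_orbit (Quotient.out ω)
  have hsum : ∑ ω, p ^ a ω = n := by
    rw [← Finset.sum_congr rfl fun ω _ => ha ω, ← Nat.card_sigma,
      ← Nat.card_congr (MulAction.selfEquivSigmaOrbits E (Fin n)), Nat.card_fin]
  have hra : r ≤ ∑ ω, a ω := by
    have h := card_le_prod_card_orbit hE.2.1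
    rw [Finset.prod_congr rfl fun ω _ => ha ω, Finset.prod_pow_eq_pow_sum, hr] at h
    exact (Nat.pow_le_pow_iff_right hp.one_lt).1 h
  refine ⟨r, hr, ?_, ?_⟩
  · calc p * r ≤ p * ∑ ω, a ω := Nat.mul_le_mul_left _ hra
      _ = ∑ ω, p * a ω := Finset.mul_sum _ _ _
      _ ≤ ∑ ω, p ^ a ω := Finset.sum_le_sum fun ω _ => mul_le_pow_of_prime hp _
      _ = n := hsum
  · rintro ⟨x, hx⟩
    let ω : MulAction.orbitRel.Quotient E (Fin n) := Quotient.mk'' x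
    have hω : MulAction.orbit E (Quotient.out ω) = MulAction.orbit E x :=
      MulAction.orbit_eq_iff.2 (Quotient.mk_out (s := MulAction.orbitRel E (Fin n)) x)
    have h2 : 2 ≤ a ω := by
      have h := ha ω
      rw [hω] at h
      rw [h] at hx
      exact (Nat.pow_lt_pow_iff_right hp.one_lt).1 (by rwa [pow_one])
    -- The large orbit has `p ^ (b + 2)` points and is counted with the sharper inequality, all
    -- other orbits with `p * a ≤ p ^ a`.
    obtain ⟨b, hb⟩ := Nat.exists_eq_add_of_le' h2
    have h3 := mul_add_le_pow_of_prime hp b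
    have h4 : ∑ ω' ∈ Finset.univ.erase ω, p * a ω' ≤ ∑ ω' ∈ Finset.univ.erase ω, p ^ a ω' :=
      Finset.sum_le_sum fun ω _ => mul_le_pow_of_prime hp _
    have h5 := Finset.add_sum_erase Finset.univ (fun ω' => p ^ a ω') (Finset.mem_univ ω)
    have h6 := Finset.add_sum_erase Finset.univ a (Finset.mem_univ ω)
    rw [← Finset.mul_sum] at h4
    rw [← h6, hb] at hra
    rw [hsum] at h5
    simp only [hb] at h5
    have h7 := Nat.mul_le_mul_left p hra
    nlinarith

/-- If all orbits have at most `p` elements, then the cycles of the elements of `E` commute. -/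
lemma cycleSet_mem_faces (hp : p.Prime) {E : Subgroup (Equiv.Perm (Fin n))}
    (hE : IsNontrivialElementaryAbelian p E)
    (h : ∀ x : Fin n, Nat.card (MulAction.orbit E x) ≤ p) :
    cycleSet p E ∈ (cycleComplex p n).faces := by
  refine ⟨cycleSet_nonempty hp hE, isMulCommutative_biSup ?_⟩
  have key : ∀ e ∈ E, ∀ f ∈ E, ∀ c ∈ e.cycleFactorsFinset, ∀ d ∈ f.cycleFactorsFinset,
      Commute c d := by
    intro e he f hf c hc d hd
    by_cases hcd : Disjoint c.support d.support
    · exact (Equiv.Perm.disjoint_iff_disjoint_support.2 hcd).commute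
    · obtain ⟨x, hxc, hxd⟩ := Finset.not_disjoint_iff.1 hcd
      obtain ⟨hc1, hc2⟩ := Equiv.Perm.mem_cycleFactorsFinset_iff.1 hc
      have hcp := card_support_of_mem_cycleFactorsFinset hp (hE.2.2 e he) hc
      have hcx := (Equiv.Perm.eq_cycleOf_of_mem_cycleFactorsFinset_iff e c hc x).2 hxc
      have hdx := (Equiv.Perm.eq_cycleOf_of_mem_cycleFactorsFinset_iff f d hd x).2 hxd
      have hsub : (c.support : Set (Fin n)) ⊆ MulAction.orbit E x := by
        intro y hy
        obtain ⟨i, rfl⟩ := hc1.exists_pow_eq (Equiv.Perm.mem_support.1 hxc)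
          (Equiv.Perm.mem_support.1 hy)
        rw [hcx, Equiv.Perm.cycleOf_pow_apply_self]
        exact ⟨⟨e ^ i, pow_mem he i⟩, rfl⟩
      -- The support of `c` has `p` points and the orbit at most `p`, so they coincide; hence `f`
      -- preserves the support.
      have horb : (c.support : Set (Fin n)) = MulAction.orbit E x := by
        refine Set.eq_of_subset_of_ncard_le hsub ?_ (Set.toFinite _)
        rw [Set.ncard_coe_finset, hcp]
        exact h x
      have hmem : ∀ y, y ∈ c.support ↔ f y ∈ c.support := by
        intro y
        rw [← Finset.mem_coe, ← Finset.mem_coe, horb]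
        rw [← MulAction.orbitRel_apply, ← MulAction.orbitRel_apply]
        have hfy : MulAction.orbitRel E (Fin n) (f y) y :=
          MulAction.orbitRel_apply.2 ⟨⟨f, hf⟩, rfl⟩
        exact ⟨(MulAction.orbitRel E (Fin n)).trans hfy,
          (MulAction.orbitRel E (Fin n)).trans ((MulAction.orbitRel E (Fin n)).symm hfy)⟩
      have hef : Commute e f := commute_of_isMulCommutative hE.2.1 he hf
      -- On its support `c` agrees with `e`, which commutes with `f`; off the support, also
      -- preserved by `f`, it is the identity.
      have hfc : Commute f c := by
        ext1 y
        rw [Equiv.Perm.mul_apply, Equiv.Perm.mul_apply]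
        by_cases hy : y ∈ c.support
        · rw [hc2 y hy, hc2 _ ((hmem y).1 hy)]
          exact (Equiv.Perm.ext_iff.1 hef y).symm
        · rw [Equiv.Perm.notMem_support.1 hy,
            Equiv.Perm.notMem_support.1 (fun h => hy ((hmem y).2 h))]
      have hfx : f x ≠ x := by
        rw [← (Equiv.Perm.mem_cycleFactorsFinset_iff.1 hd).2 x hxd]
        exact Equiv.Perm.mem_support.1 hxd
      have := zpowers_cycleOf_eq_of_commute hp hc1 hcp hfc (Equiv.Perm.mem_support.1 hxc) hfx
      rw [← hdx] at this
      have hdc : d ∈ Subgroup.zpowers c := this ▸ Subgroup.mem_zpowers d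
      obtain ⟨k, rfl⟩ := hdc
      exact (Commute.refl c).zpow_right k
  intro H hH H' hH' x hx y hy
  obtain ⟨e, he, c, hc, hHc⟩ := mem_cycleSet.1 hH
  obtain ⟨f, hf, d, hd, hHd⟩ := mem_cycleSet.1 hH'
  rw [hHc] at hx
  rw [hHd] at hy
  obtain ⟨k, rfl⟩ := hx
  obtain ⟨l, rfl⟩ := hy
  exact ((key e he f hf c hc d hd).zpow_left k).zpow_right l

/-- The length of a chain of nontrivial `p`-subgroups. -/
lemma card_chain_le (hp : p.Prime) {G : Type} [Group G] [Finite G]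
    {s : Finset (ElementaryAbelianSubgroups p G)}
    (hs : IsChain (· ≤ ·) (s : Set (ElementaryAbelianSubgroups p G)))
    {E : Subgroup G} {r : ℕ} (hr : Nat.card E = p ^ r) (hE : ∀ F ∈ s, F.1 ≤ E) : s.card ≤ r := by
  have := Fact.mk hp
  choose a ha using fun F : ElementaryAbelianSubgroups p G => IsPGroup.iff_card.1 F.2.isPGroup
  have h : s.card ≤ (Finset.Icc 1 r).card := by
    -- Comparable subgroups of equal order coincide, so the exponents of the orders are distinct
    -- along a chain.
    refine Finset.card_le_card_of_injOn a ?_ ?_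
    · intro F hF
      rw [Finset.mem_coe, Finset.mem_Icc]
      constructor
      · rw [Nat.one_le_iff_ne_zero]
        intro h0
        have := ha F
        rw [h0, pow_zero, Subgroup.card_eq_one] at this
        exact F.2.1 this
      · have := Subgroup.card_le_of_le (hE F hF)
        rw [ha, hr] at this
        exact (Nat.pow_le_pow_iff_right hp.one_lt).1 this
    · intro F hF F' hF' h
      have hcard : Nat.card F.1 = Nat.card F'.1 := by rw [ha, ha, h]
      apply Subtype.ext
      rcases hs.total hF hF' with hle | hle
      · exact Subgroup.eq_of_le_of_card_ge hle hcard.ge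
      · exact (Subgroup.eq_of_le_of_card_ge hle hcard.le).symm
  simpa using h

lemma card_le_of_isSimplex_quillenComplex (hp : p.Prime)
    {s : Finset (ElementaryAbelianSubgroups p (Equiv.Perm (Fin n)))}
    (hs : IsSimplex (quillenComplex p (Equiv.Perm (Fin n))) s) : s.card ≤ n / p := by
  rcases hs with rfl | hs
  · simp
  · obtain ⟨E, -, hE⟩ := exists_greatest_of_isChain hs.1 hs.2
    obtain ⟨r, hr, hr', -⟩ := exists_card_eq_pow hp E.2
    refine (card_chain_le hp hs.2 hr hE).trans ?_
    rw [Nat.le_div_iff_mul_le hp.pos, mul_comm]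
    exact hr'

/-- If all orbits of the top element `E` had at most `p` points, the cycles of `E` would commute,
and with them those of `F ≤ E`. So `E` has a larger orbit, and its smaller rank bounds the length of
the chain. -/
lemma card_add_le_of_notMem_faces (hp : p.Prime)
    {s : Finset (ElementaryAbelianSubgroups p (Equiv.Perm (Fin n)))}
    (hs : IsSimplex (quillenComplex p (Equiv.Perm (Fin n))) s)
    {F : ElementaryAbelianSubgroups p (Equiv.Perm (Fin n))} (hF : F ∈ s)
    (hF' : cycleSet p F.1 ∉ (cycleComplex p n).faces) : s.card + p ≤ n / p + 2 := by
  rcases hs with rfl | hs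
  · simp at hF
  · obtain ⟨E, -, hE⟩ := exists_greatest_of_isChain hs.1 hs.2
    obtain ⟨r, hr, -, hr'⟩ := exists_card_eq_pow hp E.2
    have hsr := card_chain_le hp hs.2 hr hE
    have hx : ∃ x : Fin n, p < Nat.card (MulAction.orbit E.1 x) := by
      by_contra! h
      exact hF' (((cycleComplex p n).isRelLowerSet_faces (cycleSet_mem_faces hp E.2 h)).2
        (cycleSet_mono (hE F hF)) (cycleSet_nonempty hp F.2))
    have h1 := hr' hx
    have h2 : r + p - 2 ≤ n / p := by
      rw [Nat.le_div_iff_mul_le hp.pos, Nat.sub_mul]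
      rw [mul_comm] at h1
      omega
    omega

end Orbits

/-! ### Dimensions -/

section Dim

variable {p n : ℕ}

/-- Commuting `p`-cycles that move a common point generate the same subgroup. So distinct vertices
of a face have disjoint supports of `p` points each. -/
lemma card_le_of_isSimplex_cycleComplex (hp : p.Prime) {s : Finset (CycleSubgroups p n)}
    (hs : IsSimplex (cycleComplex p n) s) : s.card ≤ n / p := by
  rcases hs with rfl | hs
  · simp
  · choose c hc1 hc2 hc3 using fun H : CycleSubgroups p n => H.2
    have hdisj : ∀ H ∈ s, ∀ H' ∈ s, H ≠ H' → Disjoint (c H).support (c H').support := by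
      intro H hH H' hH' hne
      rw [Finset.disjoint_left]
      intro x hx hx'
      have hmem : ∀ H ∈ s, c H ∈ ⨆ H ∈ s, H.1 := fun H hH =>
        (le_biSup (fun H : CycleSubgroups p n => H.1) hH : H.1 ≤ ⨆ H ∈ s, H.1)
          (by rw [hc3 H]; exact Subgroup.mem_zpowers _)
      have hcomm := commute_of_isMulCommutative hs.2 (hmem H' hH') (hmem H hH)
      have h := zpowers_cycleOf_eq_of_commute hp (hc1 H) (hc2 H) hcomm
        (Equiv.Perm.mem_support.1 hx) (Equiv.Perm.mem_support.1 hx')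
      rw [(hc1 H').cycleOf_eq (Equiv.Perm.mem_support.1 hx'), ← hc3, ← hc3] at h
      exact hne (Subtype.ext h.symm)
    rw [Nat.le_div_iff_mul_le hp.pos]
    calc s.card * p = ∑ H ∈ s, (c H).support.card := by
          rw [Finset.sum_congr rfl fun H _ => hc2 H, Finset.sum_const, smul_eq_mul]
      _ = (s.biUnion fun H => (c H).support).card :=
          (Finset.card_biUnion fun H hH H' hH' => hdisj H hH H' hH').symm
      _ ≤ Fintype.card (Fin n) := Finset.card_le_univ _
      _ = n := Fintype.card_fin n

/-- There are `⌊n / p⌋` disjoint `p`-cycles in `S_n`. -/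
lemma exists_disjoint_cycles (hp : p.Prime) (n : ℕ) :
    ∃ c : Fin (n / p) → Equiv.Perm (Fin n), (∀ i, (c i).IsCycle) ∧
      (∀ i, (c i).support.card = p) ∧ ∀ i j, i ≠ j → Disjoint (c i).support (c j).support := by
  -- The first `(n / p) * p` points are cut into blocks of length `p`, and each block is made into a
  -- cycle.
  let g : Fin (n / p) × Fin p ↪ Fin n :=
    finProdFinEquiv.toEmbedding.trans (Fin.castLEEmb (Nat.div_mul_le_self n p))
  let l : Fin (n / p) → List (Fin n) := fun i => (List.finRange p).map fun j => g (i, j)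
  have hnodup : ∀ i, (l i).Nodup := fun i => (List.nodup_finRange p).map fun j k h => by
    simpa using g.injective h
  have hlen : ∀ i, (l i).length = p := fun i => by simp [l]
  have hsupp : ∀ i, (l i).formPerm.support = (l i).toFinset := fun i =>
    List.support_formPerm_of_nodup _ (hnodup i) fun x hx => by
      have := hlen i
      rw [hx, List.length_singleton] at this
      exact hp.one_lt.ne this
  refine ⟨fun i => (l i).formPerm, fun i => List.isCycle_formPerm (hnodup i)
    (by rw [hlen]; exact hp.two_le), fun i => ?_, fun i j hij => ?_⟩
  · rw [hsupp, List.toFinset_card_of_nodup (hnodup i), hlen]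
  · rw [hsupp, hsupp, Finset.disjoint_left]
    intro x hx hx'
    simp only [l, List.mem_toFinset, List.mem_map] at hx hx'
    obtain ⟨a, -, rfl⟩ := hx
    obtain ⟨b, -, hb⟩ := hx'
    exact hij (congrArg Prod.fst (g.injective hb)).symm

lemma exists_commuting_cycleSubgroups (hp : p.Prime) (n : ℕ) :
    ∃ H : Fin (n / p) ↪ CycleSubgroups p n,
      ∀ s : Finset (Fin (n / p)), s.Nonempty → s.map H ∈ (cycleComplex p n).faces := by
  obtain ⟨c, hc1, hc2, hc3⟩ := exists_disjoint_cycles hp n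
  have hinj : Function.Injective
      fun i => (⟨Subgroup.zpowers (c i), c i, hc1 i, hc2 i, rfl⟩ : CycleSubgroups p n) := by
    intro i j h
    by_contra hij
    have hz : Subgroup.zpowers (c i) = Subgroup.zpowers (c j) := congrArg Subtype.val h
    have h' : c i ∈ Subgroup.zpowers (c j) := hz ▸ Subgroup.mem_zpowers (c i)
    obtain ⟨k, hk⟩ := h'
    have hle : (c i).support ⊆ (c j).support := hk ▸ Equiv.Perm.support_zpow_le (c j) k
    have h0 : (c i).support = ∅ := disjoint_self.1 ((hc3 i j hij).mono_right hle)
    have := hc2 i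
    rw [h0, Finset.card_empty] at this
    exact hp.ne_zero this.symm
  refine ⟨⟨_, hinj⟩, fun s hs => ⟨hs.map, isMulCommutative_biSup ?_⟩⟩
  intro H hH H' hH' x hx y hy
  obtain ⟨i, -, rfl⟩ := Finset.mem_map.1 hH
  obtain ⟨j, -, rfl⟩ := Finset.mem_map.1 hH'
  obtain ⟨k, rfl⟩ := hx
  obtain ⟨l, rfl⟩ := hy
  refine Commute.zpow_left (Commute.zpow_right ?_ l) k
  rcases eq_or_ne i j with rfl | hij
  · exact Commute.refl _
  · exact (Equiv.Perm.disjoint_iff_disjoint_support.2 (hc3 i j hij)).commute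

theorem hasDim_cycleComplex (hp : p.Prime) (n : ℕ) :
    HasDim (cycleComplex p n) (((n / p : ℕ) : ℤ) - 1) := by
  constructor
  · obtain ⟨H, hH⟩ := exists_commuting_cycleSubgroups hp n
    refine ⟨Finset.univ.map H, ?_, by simp⟩
    -- For `n < p` there are no cycles, and the empty simplex realizes the dimension -1.
    rcases (Finset.univ : Finset (Fin (n / p))).eq_empty_or_nonempty with h | h
    · left; rw [h, Finset.map_empty]
    · right; exact hH _ h
  · rintro e ⟨s, hs, rfl⟩
    have := card_le_of_isSimplex_cycleComplex hp hs
    omega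

theorem hasDim_quillenComplex (hp : p.Prime) (n : ℕ) :
    HasDim (quillenComplex p (Equiv.Perm (Fin n))) (((n / p : ℕ) : ℤ) - 1) := by
  constructor
  · obtain ⟨H, hH⟩ := exists_commuting_cycleSubgroups hp n
    have hface : ∀ i, (Finset.Iic i).map H ∈ (cycleComplex p n).faces := fun i =>
      hH _ ⟨i, Finset.mem_Iic.2 le_rfl⟩
    -- A maximal chain is formed by the groups generated by initial segments of the disjoint cycles;
    -- `cycleSet` recovers the segment, so the groups are distinct.
    let E : Fin (n / p) → ElementaryAbelianSubgroups p (Equiv.Perm (Fin n)) := fun i =>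
      ⟨⨆ C ∈ (Finset.Iic i).map H, C.1, isNontrivialElementaryAbelian_biSup (hface i)⟩
    have hinj : Function.Injective E := by
      intro i j h
      have h1 : cycleSet p (E i).1 = cycleSet p (E j).1 := by rw [h]
      rw [cycleSet_biSup hp (hface i).2, cycleSet_biSup hp (hface j).2, Finset.map_inj] at h1
      exact le_antisymm (Finset.Iic_subset_Iic.1 h1.subset) (Finset.Iic_subset_Iic.1 h1.superset)
    have hmono : Monotone E := by
      intro i j hij
      change (⨆ C ∈ (Finset.Iic i).map H, C.1) ≤ ⨆ C ∈ (Finset.Iic j).map H, C.1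
      exact biSup_mono fun C hC => Finset.map_subset_map.2 (Finset.Iic_subset_Iic.2 hij) hC
    refine ⟨Finset.univ.map ⟨E, hinj⟩, ?_, by simp⟩
    rcases (Finset.univ : Finset (Fin (n / p))).eq_empty_or_nonempty with h | h
    · left; rw [h, Finset.map_empty]
    · right
      refine ⟨h.map, ?_⟩
      intro x hx y hy _
      obtain ⟨i, -, rfl⟩ := Finset.mem_map.1 hx
      obtain ⟨j, -, rfl⟩ := Finset.mem_map.1 hy
      exact (le_total i j).imp (fun h => hmono h) (fun h => hmono h)
  · rintro e ⟨s, hs, rfl⟩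
    have := card_le_of_isSimplex_quillenComplex hp hs
    omega

end Dim

end SimplicialRep

end

theorem theorem3p2 (p n : ℕ) (hp : p.Prime) (hn : 0 < n) (t : ℤ)
    (ht : t = ((n / p : ℕ) : ℤ) - 1) :
    SimplicialRep.HasDim (SimplicialRep.quillenComplex p (Equiv.Perm (Fin n))) t ∧
    SimplicialRep.HasDim (SimplicialRep.cycleComplex p n) t ∧
    ∀ j : ℤ, t - ((p : ℤ) - 3) ≤ j →
      Nonempty
        (SimplicialRep.reducedHomology (Equiv.Perm (Fin n))
            (SimplicialRep.quillenComplex p (Equiv.Perm (Fin n))) j ≅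
          SimplicialRep.reducedHomology (Equiv.Perm (Fin n))
            (SimplicialRep.cycleComplex p n) j) := by
  subst ht
  refine ⟨SimplicialRep.hasDim_quillenComplex hp n, SimplicialRep.hasDim_cycleComplex hp n,
    fun j hj => ?_⟩
  obtain ⟨e⟩ := SimplicialRep.nonempty_reducedHomology_commutingCycleSubgroups_iso hp n j
  obtain ⟨f⟩ :=
    SimplicialRep.nonempty_reducedHomology_commutingCycleSubgroups_iso_quillenComplex p n j
      fun s hs hsj F hF => by
        -- A simplex leaving P has at most `n / p + 2 - p` vertices, one fewer than the least value
        -- of `j + 1`.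
        by_contra hF'
        have := SimplicialRep.card_add_le_of_notMem_faces hp hs hF hF'
        omega
  exact ⟨f.symm ≪≫ e⟩
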